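/- Let $(\Omega,\mathcal A,\mathbb P)$ be a probability space and let $n\ge 3$. Let $\mathcal D_n(\mathrm U[-1,1],\ldots,\mathrm U[-1,1])$ denote the set of all distributions of sums $X_1+\cdots+X_n$, where $X_1,\ldots,X_n$ are random variables on $(\Omega,\mathcal A,\mathbb P)$, with arbitrary dependence, each uniformly distributed on $[-1,1]$. If $F\in\mathcal D_n(\mathrm U[-1,1],\ldots,\mathrm U[-1,1])$, then for every $a\in[0,1]$ the distribution $F_a$ of $aX$, where $X\sim F$, also belongs to $\mathcal D_n(\mathrm U[-1,1],\ldots,\mathrm U[-1,1])$. -/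

import Mathlib

/-- The uniform distribution `U[a, b]` on the interval `[a, b]`, for `a < b`: normalised Lebesgue
measure on `[a, b]`. -/
noncomputable def uniformLaw (a b : ℝ) : MeasureTheory.Measure ℝ :=
  ProbabilityTheory.cond MeasureTheory.volume (Set.Icc a b)

/-- The set `D_n(F₁, …, Fₙ)` of all possible distributions of a sum `X₁ + ⋯ + Xₙ`, where
`X₁, …, Xₙ` are real random variables on the probability space `(Ω, P)`, with arbitrary dependence,
such that `Xᵢ` has distribution `Fᵢ`. -/
def sumLaws {Ω : Type*} [MeasurableSpace Ω] (P : MeasureTheory.Measure Ω) {n : ℕ}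
    (F : Fin n → MeasureTheory.Measure ℝ) : Set (MeasureTheory.Measure ℝ) :=
  {G | ∃ X : Fin n → Ω → ℝ,
    (∀ i, Measurable (X i)) ∧ (∀ i, P.map (X i) = F i) ∧ P.map (fun ω => ∑ i, X i ω) = G}

/-- The distribution `F_a` of `a X`, where `X` has distribution `F`. -/
noncomputable def scaledLaw (a : ℝ) (F : MeasureTheory.Measure ℝ) : MeasureTheory.Measure ℝ :=
  F.map (fun x => a * x)

/-! If `X₁, …, Xₙ` are uniform on `[-1, 1]`, then `a (X₁ + ⋯ + Xₙ) / n` is a subconvex combination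
of them, so by Jensen its law is dominated by `U[-1, 1]` in the convex order
(`uniformDominated_combination`). It therefore suffices that for `n ≥ 3` every law dominated in this
sense is the law of an average of `n` uniform variables.

This is a transport problem with prescribed marginals. By Riesz extension and Riesz–Markov
(`DualBound.exists_coupling`) it is solvable once a dual inequality between integrals of continuous
functions holds (`DualBound`). That inequality is proved by induction on `n`: `DualBound.succ` turns
a coupling for `n` into the bound for `n + 1`, and the main work is `n = 3`.

For `n = 3`, averaging over small bins replaces the law by finitely many atoms (`dualBound_three`).
Among three atoms, mass is either spread from the middle one to the outer two or contracted the
other way, whichever does not decrease the objective, until an atom vanishes or the convex order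
becomes tight at an interior point and the problem splits in two (`AtomsDominated.sum_le`). At most
two atoms remain.

One atom means three uniform variables with constant sum. Two atoms (`two_point`) mean splitting the
uniform density into two parts, each the marginal of a triple with constant sum. The building blocks
are linear densities (`linear_density`), Archimedes' theorem on the projection of the sphere
(`box_mean_le`), and peeling off boundaries of hexagonal sections of cubes (`peel`). -/

open MeasureTheory intervalIntegral Set

/-! ### Antithetic pairs and integration by parts. -/

/-- The integral over a symmetric pair `(x, s - x)`. -/
lemma integral_add_reflect (f : ℝ → ℝ) (hf : Continuous f) (l r : ℝ) :
    ∫ x in l..r, (f x + f (l + r - x)) = 2 * ∫ x in l..r, f x := by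
  rw [integral_add (hf.intervalIntegrable _ _)
    (Continuous.intervalIntegrable (by fun_prop) _ _), integral_comp_sub_left]
  simp only [add_sub_cancel_right, add_sub_cancel_left]
  ring

/-- Averaging `A ≤ f t + f x + f y` over an antithetic uniform pair `(x, y)` on `[l, r]`. -/
lemma edge_le (f : ℝ → ℝ) (hf : Continuous f) {A t l r : ℝ} (hlr : l ≤ r)
    (h : ∀ x ∈ Icc l r, A ≤ f t + f x + f (l + r - x)) :
    A * (r - l) ≤ (r - l) * f t + 2 * ∫ x in l..r, f x := by
  have h1 : ∫ x in l..r, A ≤ ∫ x in l..r, (f t + (f x + f (l + r - x))) := by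
    apply integral_mono_on hlr (by simp) (Continuous.intervalIntegrable (by fun_prop) _ _)
    intro x hx
    linarith [h x hx]
  rw [integral_add (by simp) (Continuous.intervalIntegrable (by fun_prop) _ _),
    integral_add_reflect f hf] at h1
  simp only [intervalIntegral.integral_const, smul_eq_mul] at h1
  linarith

lemma hasDerivAt_primitive (f : ℝ → ℝ) (hf : Continuous f) (a x : ℝ) :
    HasDerivAt (fun u => ∫ t in a..u, f t) (f x) x :=
  integral_hasDerivAt_right (hf.intervalIntegrable _ _)
    (hf.stronglyMeasurableAtFilter _ _) hf.continuousAt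

lemma continuous_primitive_of_continuous (f : ℝ → ℝ) (hf : Continuous f) (a : ℝ) :
    Continuous (fun u => ∫ t in a..u, f t) :=
  continuous_iff_continuousAt.2 fun x => (hasDerivAt_primitive f hf a x).continuousAt

lemma exists_primitive (f : ℝ → ℝ) (hf : Continuous f) :
    ∃ F : ℝ → ℝ, Continuous F ∧ (∀ x, HasDerivAt F (f x) x) ∧
      ∀ u v, ∫ t in u..v, f t = F v - F u :=
  ⟨fun u => ∫ t in (0 : ℝ)..u, f t, continuous_primitive_of_continuous f hf 0,
    hasDerivAt_primitive f hf 0, fun _ _ => (integral_interval_sub_left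
      (hf.intervalIntegrable _ _) (hf.intervalIntegrable _ _)).symm⟩

/-- Integration by parts against a primitive `F` of `f`. -/
lemma integral_deriv_mul_primitive {f F g g' : ℝ → ℝ} (hf : Continuous f) (hF : Continuous F)
    (hFf : ∀ x, HasDerivAt F (f x) x) (hg' : Continuous g')
    (hg : ∀ x, HasDerivAt g (g' x) x) (l r : ℝ) :
    ∫ x in l..r, g' x * F x = g r * F r - g l * F l - ∫ x in l..r, g x * f x := by
  have hgc : Continuous g := continuous_iff_continuousAt.2 fun x => (hg x).continuousAt
  have h1 : ∫ x in l..r, (g' x * F x + g x * f x) = _ :=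
    integral_eq_sub_of_hasDerivAt (fun x _ => (hg x).mul (hFf x))
      (Continuous.intervalIntegrable (by fun_prop) _ _)
  rw [intervalIntegral.integral_add (Continuous.intervalIntegrable (by fun_prop) _ _)
    (Continuous.intervalIntegrable (by fun_prop) _ _)] at h1
  simp only [Pi.mul_apply] at h1
  linarith

lemma integral_quadratic_mul {f : ℝ → ℝ} (hf : Continuous f) (a₀ a₁ a₂ l r : ℝ) :
    ∫ x in l..r, (a₀ + a₁ * x + a₂ * x ^ 2) * f x =
      a₀ * (∫ x in l..r, f x) + a₁ * (∫ x in l..r, x * f x) + a₂ * ∫ x in l..r, x ^ 2 * f x := by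
  simp only [← intervalIntegral.integral_const_mul]
  rw [← intervalIntegral.integral_add, ← intervalIntegral.integral_add]
  · congr 1 with x; ring
  all_goals exact Continuous.intervalIntegrable (by fun_prop) _ _

/-! ### Triples with a linear density and constant sum. -/

set_option maxHeartbeats 1000000 in
-- The plane `x + y + z = c` cuts the cube in a hexagon. The slice where one coordinate equals `t`
-- is a segment on which the other two form an antithetic uniform pair. Mixing these slices with
-- weight `2 |t - (c - 1)|` times their length, of total mass `1 / 3`, and adding the three
-- marginals gives the linear density of the statement. Integration by parts removes the primitive
-- `F` of `f` from the two weighted integrals.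
lemma linear_density_low (f : ℝ → ℝ) (hf : Continuous f) {A c : ℝ} (hc : 1 ≤ c) (hc' : c ≤ 3 / 2)
    (h : ∀ x ∈ Icc (0 : ℝ) 1, ∀ y ∈ Icc (0 : ℝ) 1, ∀ z ∈ Icc (0 : ℝ) 1, x + y + z = c →
      A ≤ f x + f y + f z) :
    A ≤ 3 * ∫ x in (0 : ℝ)..1, f x * (4 - 2 * c + (4 * c - 6) * x) := by
  obtain ⟨F, hF, hFf, hFsub⟩ := exists_primitive f hf
  have e1 : ∀ t ∈ Icc 0 (c - 1),
      A * (2 - c + t) ≤ (2 - c + t) * f t + 2 * (F 1 - F (c - 1 - t)) := by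
    intro t ht
    have := edge_le f hf (A := A) (t := t) (l := c - 1 - t) (r := 1) (by linarith [ht.1]) (by
      intro x hx
      refine h _ ⟨?_, ?_⟩ _ ⟨?_, ?_⟩ _ ⟨?_, ?_⟩ ?_ <;> linarith [ht.1, ht.2, hx.1, hx.2])
    rw [hFsub] at this
    linarith
  have e2 : ∀ t ∈ Icc (c - 1) 1, A * (c - t) ≤ (c - t) * f t + 2 * (F (c - t) - F 0) := by
    intro t ht
    have := edge_le f hf (A := A) (t := t) (l := 0) (r := c - t) (by linarith [ht.2]) (by
      intro x hx
      refine h _ ⟨?_, ?_⟩ _ ⟨?_, ?_⟩ _ ⟨?_, ?_⟩ ?_ <;> linarith [ht.1, ht.2, hx.1, hx.2])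
    rw [hFsub] at this
    linarith
  -- The weight changes form at `t = c - 1`, where the slice is the longest and the weight vanishes.
  have i1 : ∫ t in 0..(c - 1), 2 * (c - 1 - t) * (A * (2 - c + t)) ≤
      ∫ t in 0..(c - 1), (2 * (c - 1 - t) * ((2 - c + t) * f t + 2 * F 1)
        - 4 * ((c - 1 - t) * F (c - 1 - t))) := by
    apply integral_mono_on (by linarith) (Continuous.intervalIntegrable (by fun_prop) _ _)
      (Continuous.intervalIntegrable (by fun_prop) _ _)
    intro t ht
    nlinarith [mul_le_mul_of_nonneg_left (e1 t ht) (show 0 ≤ 2 * (c - 1 - t) by linarith [ht.2])]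
  have i2 : ∫ t in (c - 1)..1, 2 * (t - (c - 1)) * (A * (c - t)) ≤
      ∫ t in (c - 1)..1, (2 * (t - (c - 1)) * ((c - t) * f t - 2 * F 0)
        + 4 * ((1 - (c - t)) * F (c - t))) := by
    apply integral_mono_on (by linarith) (Continuous.intervalIntegrable (by fun_prop) _ _)
      (Continuous.intervalIntegrable (by fun_prop) _ _)
    intro t ht
    nlinarith [mul_le_mul_of_nonneg_left (e2 t ht) (show 0 ≤ 2 * (t - (c - 1)) by linarith [ht.1])]
  have s1 : ∫ t in 0..(c - 1), (c - 1 - t) * F (c - 1 - t) = ∫ u in 0..(c - 1), u * F u := by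
    rw [integral_comp_sub_left (fun u => u * F u)]; simp
  have s2 : ∫ t in (c - 1)..1, (1 - (c - t)) * F (c - t) = ∫ u in (c - 1)..1, (1 - u) * F u := by
    rw [integral_comp_sub_left (fun u => (1 - u) * F u)]; simp
  have p1 := integral_deriv_mul_primitive (g := fun u => u ^ 2 / 2) (g' := fun u => u) hf hF hFf continuous_id
    (fun x => by simpa using (hasDerivAt_pow 2 x).div_const 2) 0 (c - 1)
  have p2 := integral_deriv_mul_primitive (g := fun u => - (1 - u) ^ 2 / 2) (g' := fun u => 1 - u) hf hF hFf
    (by fun_prop)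
    (fun x => by
      convert! ((((hasDerivAt_id x).const_sub 1).pow 2).neg).div_const 2 using 1
      simp) (c - 1) 1
  have q1 := integral_quadratic_mul (f := fun _ => 1) continuous_const (A * 2 * (c - 1) * (2 - c))
    (A * 2 * (2 * c - 3)) (-2 * A) 0 (c - 1)
  have q2 := integral_quadratic_mul (f := fun _ => 1) continuous_const (-2 * A * (c - 1) * c)
    (A * 2 * (2 * c - 1)) (-2 * A) (c - 1) 1
  have q3 := integral_quadratic_mul (f := fun _ => 1) continuous_const (4 * F 1 * (c - 1))
    (-4 * F 1) 0 0 (c - 1)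
  have q3' := integral_quadratic_mul (f := fun _ => 1) continuous_const (4 * F 0 * (c - 1))
    (-4 * F 0) 0 (c - 1) 1
  have q4 := integral_quadratic_mul hf (2 * (c - 1) * (2 - c)) (2 * (2 * c - 3)) (-2) 0 (c - 1)
  have q5 := integral_quadratic_mul hf (-2 * (c - 1) * c) (2 * (2 * c - 1)) (-2) (c - 1) 1
  have q6 := integral_quadratic_mul hf 0 0 (1 / 2) 0 (c - 1)
  have q7 := integral_quadratic_mul hf (-1 / 2) 1 (-1 / 2) (c - 1) 1
  have q8 := integral_quadratic_mul hf (4 - 2 * c) (4 * c - 6) 0 0 (c - 1)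
  have q9 := integral_quadratic_mul hf (4 - 2 * c) (4 * c - 6) 0 (c - 1) 1
  have r1 : ∫ t in 0..(c - 1), (2 * (c - 1 - t) * ((2 - c + t) * f t + 2 * F 1)
        - 4 * ((c - 1 - t) * F (c - 1 - t))) = 
      (∫ t in 0..(c - 1), (2 * (c - 1) * (2 - c) + 2 * (2 * c - 3) * t + (-2) * t ^ 2) * f t)
      + (∫ t in 0..(c - 1), (4 * F 1 * (c - 1) + -4 * F 1 * t + 0 * t ^ 2) * 1)
      - 4 * ∫ u in 0..(c - 1), u * F u := by
    rw [← s1, ← intervalIntegral.integral_const_mul, ← intervalIntegral.integral_add, ← intervalIntegral.integral_sub]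
    · congr 1 with t; ring
    all_goals exact Continuous.intervalIntegrable (by fun_prop) _ _
  have r2 : ∫ t in (c - 1)..1, (2 * (t - (c - 1)) * ((c - t) * f t - 2 * F 0)
        + 4 * ((1 - (c - t)) * F (c - t))) = 
      (∫ t in (c - 1)..1, (-2 * (c - 1) * c + 2 * (2 * c - 1) * t + (-2) * t ^ 2) * f t)
      + (∫ t in (c - 1)..1, (4 * F 0 * (c - 1) + -4 * F 0 * t + 0 * t ^ 2) * 1)
      + 4 * ∫ u in (c - 1)..1, (1 - u) * F u := by
    rw [← s2, ← intervalIntegral.integral_const_mul, ← intervalIntegral.integral_add,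
      ← intervalIntegral.integral_add]
    · congr 1 with t; ring
    all_goals exact Continuous.intervalIntegrable (by fun_prop) _ _
  have r3 : ∫ x in (0 : ℝ)..1, f x * (4 - 2 * c + (4 * c - 6) * x) = 
      (∫ x in 0..(c - 1), (4 - 2 * c + (4 * c - 6) * x + 0 * x ^ 2) * f x) +
      (∫ x in (c - 1)..1, (4 - 2 * c + (4 * c - 6) * x + 0 * x ^ 2) * f x) := by
    rw [integral_add_adjacent_intervals]
    · congr 1 with t; ring
    all_goals exact Continuous.intervalIntegrable (by fun_prop) _ _
  have r4 : ∫ t in 0..(c - 1), 2 * (c - 1 - t) * (A * (2 - c + t)) =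
      ∫ t in 0..(c - 1), (A * 2 * (c - 1) * (2 - c) + A * 2 * (2 * c - 3) * t + -2 * A * t ^ 2) * 1 := by
    congr 1 with t; ring
  have r5 : ∫ t in (c - 1)..1, 2 * (t - (c - 1)) * (A * (c - t)) =
      ∫ t in (c - 1)..1, (-2 * A * (c - 1) * c + A * 2 * (2 * c - 1) * t + -2 * A * t ^ 2) * 1 := by
    congr 1 with t; ring
  have p1' : ∫ x in 0..(c - 1), x ^ 2 / 2 * f x =
      ∫ x in 0..(c - 1), (0 + 0 * x + 1 / 2 * x ^ 2) * f x := by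
    congr 1 with t; ring
  have p2' : ∫ x in (c - 1)..1, -(1 - x) ^ 2 / 2 * f x =
      ∫ x in (c - 1)..1, (-1 / 2 + 1 * x + -1 / 2 * x ^ 2) * f x := by
    congr 1 with t; ring
  simp only [mul_one, integral_id, integral_pow, intervalIntegral.integral_const, smul_eq_mul]
    at q1 q2 q3 q3'
  rw [r4, r1] at i1
  rw [r5, r2] at i2
  simp only [mul_one] at i1 i2
  rw [q1, q3, q4, p1, p1', q6] at i1
  rw [q2, q3', q5, p2, p2', q7] at i2
  rw [r3, q8, q9]
  simp only [hFsub] at i1 i2 ⊢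
  norm_num at i1 i2
  linarith only [i1, i2]

lemma linear_density (f : ℝ → ℝ) (hf : Continuous f) {A c : ℝ} (hc : 1 ≤ c) (hc' : c ≤ 2)
    (h : ∀ x ∈ Icc (0 : ℝ) 1, ∀ y ∈ Icc (0 : ℝ) 1, ∀ z ∈ Icc (0 : ℝ) 1, x + y + z = c →
      A ≤ f x + f y + f z) :
    A ≤ 3 * ∫ x in (0 : ℝ)..1, f x * (4 - 2 * c + (4 * c - 6) * x) := by
  rcases le_total c (3 / 2) with hc2 | hc2
  · exact linear_density_low f hf hc hc2 h
  -- The symmetry `x ↦ 1 - x` of the cube exchanges `c` and `3 - c`.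
  · have := linear_density_low (fun x => f (1 - x)) (by fun_prop) (A := A) (c := 3 - c)
      (by linarith) (by linarith) (by
        intro x hx y hy z hz hs
        refine h _ ⟨?_, ?_⟩ _ ⟨?_, ?_⟩ _ ⟨?_, ?_⟩ ?_ <;>
          linarith [hx.1, hx.2, hy.1, hy.2, hz.1, hz.2])
    convert! this using 2
    have e := integral_comp_sub_left (a := 0) (b := 1)
      (fun x => f x * (4 - 2 * c + (4 * c - 6) * x)) (1 : ℝ)
    simp only [sub_self, sub_zero] at e
    rw [← e]
    congr 1 with x
    ring

/-- Three uniform variables on `[a, b]` can be coupled with constant sum. -/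
lemma uniform_block (f : ℝ → ℝ) (hf : Continuous f) {A a b : ℝ} (hab : a ≤ b)
    (h : ∀ x ∈ Icc a b, ∀ y ∈ Icc a b, ∀ z ∈ Icc a b, x + y + z = 3 * (a + b) / 2 →
      A ≤ f x + f y + f z) :
    (b - a) * A ≤ 3 * ∫ x in a..b, f x := by
  -- At `c = 3 / 2` the linear density is constant.
  have := linear_density (fun u => f ((b - a) * u + a)) (by fun_prop) (A := A) (c := 3 / 2)
    (by norm_num) (by norm_num) (by
      intro x hx y hy z hz hs
      refine h _ ⟨?_, ?_⟩ _ ⟨?_, ?_⟩ _ ⟨?_, ?_⟩ ?_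
      any_goals nlinarith [hx.1, hx.2, hy.1, hy.2, hz.1, hz.2])
  have e := mul_integral_comp_mul_add (a := 0) (b := 1) (f := f) (b - a) a
  have e2 : ∫ u in (0 : ℝ)..1, f ((b - a) * u + a) * (4 - 2 * (3 / 2) + (4 * (3 / 2) - 6) * u) =
      ∫ u in (0 : ℝ)..1, f ((b - a) * u + a) := by
    congr 1 with u; ring
  rw [e2] at this
  have e3 : (b - a) * 0 + a = a := by ring
  have e4 : (b - a) * 1 + a = b := by ring
  rw [e3, e4] at e
  nlinarith [mul_le_mul_of_nonneg_left this (sub_nonneg.2 hab)]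

/-! ### Archimedes' theorem and uniform variables on intervals of different lengths. -/

lemma lintegral_inv_sqrt_sub_sq {σ : ℝ} (hσ : 0 < σ) :
    ∫⁻ y : ℝ, ENNReal.ofReal ((√(σ - y ^ 2))⁻¹) = ENNReal.ofReal Real.pi := by
  set s := √σ with hs
  have hs0 : 0 < s := Real.sqrt_pos.2 hσ
  have hss : s ^ 2 = σ := Real.sq_sqrt hσ.le
  have hcont : ContinuousOn (fun y => Real.arcsin (y / s)) (Icc (-s) s) :=
    (Real.continuous_arcsin.comp (continuous_id.div_const s)).continuousOn
  have hder : ∀ y ∈ Ioo (-s) s, HasDerivAt (fun y => Real.arcsin (y / s)) ((√(σ - y ^ 2))⁻¹) y := by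
    intro y hy
    have h1 : y / s ≠ -1 := by
      intro h; rw [div_eq_iff hs0.ne'] at h; linarith [hy.1]
    have h2 : y / s ≠ 1 := by
      intro h; rw [div_eq_iff hs0.ne'] at h; linarith [hy.2]
    have := (Real.hasDerivAt_arcsin h1 h2).comp y ((hasDerivAt_id y).div_const s)
    convert! this using 1
    have e : σ - y ^ 2 = s ^ 2 * (1 - (id y / s) ^ 2) := by
      simp only [id]; field_simp; linarith
    rw [e, Real.sqrt_mul (by positivity), Real.sqrt_sq hs0.le]
    simp only [id]
    rw [mul_inv, one_div, mul_comm, one_div]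
  have hpos : ∀ y ∈ Ioo (-s) s, 0 ≤ (√(σ - y ^ 2))⁻¹ := fun y _ => by positivity
  have hint : IntegrableOn (fun y => (√(σ - y ^ 2))⁻¹) (Ioc (-s) s) :=
    integrableOn_deriv_of_nonneg hcont hder hpos
  have hval : ∫ y in (-s)..s, (√(σ - y ^ 2))⁻¹ = Real.pi := by
    rw [integral_eq_sub_of_hasDerivAt_of_le (by linarith) hcont hder
      ((intervalIntegrable_iff_integrableOn_Ioc_of_le (by linarith)).2 hint)]
    rw [div_self hs0.ne', neg_div, div_self hs0.ne', Real.arcsin_neg, Real.arcsin_one]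
    ring
  rw [← hval, integral_of_le (by linarith),
    ofReal_integral_eq_lintegral_ofReal hint (Filter.Eventually.of_forall fun y => by positivity),
    ← lintegral_indicator measurableSet_Ioc]
  congr 1 with y
  by_cases hy : y ∈ Ioc (-s) s
  · rw [indicator_of_mem hy]
  -- Outside the interval the root of a nonpositive number is `0`, and so is its inverse.
  · rw [indicator_of_notMem hy, Real.sqrt_eq_zero_of_nonpos]
    · simp
    · rw [← hss]
      simp only [mem_Ioc, not_and_or, not_lt, not_le] at hy
      rcases hy with hy | hy <;> nlinarith

/-- The projection to `ℂ` of the uniform distribution on the unit sphere of `ℝ³`. -/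
noncomputable def sphereProjection : Measure ℂ :=
  volume.withDensity fun z => ENNReal.ofReal ((2 * Real.pi)⁻¹ * (√(1 - ‖z‖ ^ 2))⁻¹)

/-- Archimedes: the integral of the density over each vertical chord of the disc is `π / (2π)`,
whatever the abscissa. With rotation invariance, every `Re (w z)` with `|w| = 1` is then uniform on
`[-1, 1]`. -/
lemma map_re_sphereProjection :
    sphereProjection.map Complex.re = (2 : ENNReal)⁻¹ • volume.restrict (Icc (-1 : ℝ) 1) := by
  ext s hs
  rw [Measure.map_apply Complex.measurable_re hs, sphereProjection,
    withDensity_apply _ (Complex.measurable_re hs), ← lintegral_indicator (Complex.measurable_re hs),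
    ← Complex.volume_preserving_equiv_real_prod.symm.lintegral_comp_emb
      (MeasurableEquiv.measurableEmbedding _)]
  rw [Measure.volume_eq_prod, lintegral_prod _ (by
    apply Measurable.aemeasurable
    refine Measurable.comp (Measurable.indicator ?_ (Complex.measurable_re hs))
      (MeasurableEquiv.measurable _)
    fun_prop)]
  have key : ∀ x : ℝ, ∫⁻ y : ℝ, ((Complex.re ⁻¹' s).indicator
      (fun z => ENNReal.ofReal ((2 * Real.pi)⁻¹ * (√(1 - ‖z‖ ^ 2))⁻¹))
      (Complex.measurableEquivRealProd.symm (x, y))) =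
      s.indicator ((Ioo (-1 : ℝ) 1).indicator fun _ => (2 : ENNReal)⁻¹) x := by
    intro x
    have hn : ∀ y : ℝ, ‖Complex.measurableEquivRealProd.symm (x, y)‖ ^ 2 = x ^ 2 + y ^ 2 := by
      intro y
      rw [Complex.sq_norm, Complex.normSq_apply]
      simp [Complex.measurableEquivRealProd, sq]
    by_cases hx : x ∈ s
    · have hm : ∀ y : ℝ, Complex.measurableEquivRealProd.symm (x, y) ∈ Complex.re ⁻¹' s := by
        intro y; simpa [Complex.measurableEquivRealProd] using hx
      simp_rw [indicator_of_mem (hm _), hn, indicator_of_mem hx]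
      by_cases hx1 : x ∈ Ioo (-1 : ℝ) 1
      · rw [indicator_of_mem hx1]
        have hσ : 0 < 1 - x ^ 2 := by nlinarith [hx1.1, hx1.2]
        have e : ∀ y : ℝ, ENNReal.ofReal ((2 * Real.pi)⁻¹ * (√(1 - (x ^ 2 + y ^ 2)))⁻¹) =
            ENNReal.ofReal ((2 * Real.pi)⁻¹) * ENNReal.ofReal ((√(1 - x ^ 2 - y ^ 2))⁻¹) := by
          intro y
          rw [← ENNReal.ofReal_mul (by positivity), sub_add_eq_sub_sub]
        simp_rw [e]
        rw [lintegral_const_mul _ (by fun_prop), lintegral_inv_sqrt_sub_sq hσ,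
          ← ENNReal.ofReal_mul (by positivity)]
        have : (2 * Real.pi)⁻¹ * Real.pi = 2⁻¹ := by field_simp
        rw [this, ENNReal.ofReal_inv_of_pos (by norm_num)]
        simp
      · rw [indicator_of_notMem hx1]
        have e : ∀ y : ℝ, √(1 - (x ^ 2 + y ^ 2)) = 0 := by
          intro y
          apply Real.sqrt_eq_zero_of_nonpos
          simp only [mem_Ioo, not_and_or, not_lt] at hx1
          rcases hx1 with h | h <;> nlinarith [sq_nonneg y]
        simp [e]
    · have hm : ∀ y : ℝ, Complex.measurableEquivRealProd.symm (x, y) ∉ Complex.re ⁻¹' s := by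
        intro y; simpa [Complex.measurableEquivRealProd] using hx
      simp_rw [indicator_of_notMem (hm _), indicator_of_notMem hx]
      simp
  simp_rw [key]
  rw [lintegral_indicator hs, lintegral_indicator measurableSet_Ioo]
  simp only [lintegral_const, Measure.smul_apply, Measure.restrict_apply hs, smul_eq_mul,
    Measure.restrict_apply MeasurableSet.univ, univ_inter,
    Measure.restrict_apply measurableSet_Ioo]
  congr 1
  rw [inter_comm]
  exact measure_congr (Filter.EventuallyEq.rfl.inter Ioo_ae_eq_Icc)

lemma map_mul_sphereProjection (w : Circle) :
    sphereProjection.map (fun z => (w : ℂ) * z) = sphereProjection := by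
  have h : MeasurePreserving (rotation w) (volume : Measure ℂ) volume :=
    (rotation w).measurePreserving
  ext s hs
  have hm : Measurable (fun z : ℂ => (w : ℂ) * z) := by fun_prop
  rw [Measure.map_apply hm hs, sphereProjection, withDensity_apply _ hs,
    withDensity_apply _ (hm hs),
    ← h.setLIntegral_comp_preimage hs (by fun_prop)]
  simp only [rotation_apply, norm_mul, Circle.norm_coe, one_mul]
  rfl

lemma map_re_mul_sphereProjection (w : Circle) :
    sphereProjection.map (fun z => ((w : ℂ) * z).re) =
      (2 : ENNReal)⁻¹ • volume.restrict (Icc (-1 : ℝ) 1) := by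
  rw [← map_re_sphereProjection, ← map_mul_sphereProjection w,
    Measure.map_map Complex.measurable_re (by fun_prop), map_mul_sphereProjection w]
  rfl

instance : IsProbabilityMeasure sphereProjection := by
  have h := map_re_sphereProjection
  have h2 : sphereProjection.map Complex.re univ = 1 := by
    rw [h]
    simp only [Measure.smul_apply, Measure.restrict_apply_univ, Real.volume_Icc, smul_eq_mul]
    norm_num
    exact ENNReal.inv_mul_cancel (by simp) (by simp)
  rw [Measure.map_apply Complex.measurable_re MeasurableSet.univ] at h2
  exact ⟨by simpa using h2⟩

lemma ae_re_mul_mem_Icc (w : Circle) :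
    ∀ᵐ z ∂sphereProjection, ((w : ℂ) * z).re ∈ Icc (-1 : ℝ) 1 := by
  have hm : Measurable (fun z : ℂ => ((w : ℂ) * z).re) := by fun_prop
  apply ae_of_ae_map hm.aemeasurable
  rw [map_re_mul_sphereProjection]
  exact Measure.ae_smul_measure (ae_restrict_mem measurableSet_Icc) _

lemma integrable_re_mul_sphereProjection (w : Circle) (g : ℝ → ℝ) (hg : Continuous g) :
    Integrable (fun z => g (((w : ℂ) * z).re)) sphereProjection := by
  have hm : Measurable (fun z : ℂ => ((w : ℂ) * z).re) := by fun_prop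
  have : Integrable g (sphereProjection.map (fun z => ((w : ℂ) * z).re)) := by
    rw [map_re_mul_sphereProjection]
    exact (hg.integrableOn_Icc.integrable).smul_measure (by simp)
  exact this.comp_measurable hm

lemma integral_re_mul_sphereProjection (w : Circle) (g : ℝ → ℝ) (hg : Continuous g) :
    ∫ z, g (((w : ℂ) * z).re) ∂sphereProjection = 2⁻¹ * ∫ x in (-1 : ℝ)..1, g x := by
  have hm : Measurable (fun z : ℂ => ((w : ℂ) * z).re) := by fun_prop
  rw [← integral_map hm.aemeasurable hg.aestronglyMeasurable, map_re_mul_sphereProjection,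
    MeasureTheory.integral_smul_measure, integral_of_le (by norm_num), integral_Icc_eq_integral_Ioc]
  simp

/-- The side lengths of a (possibly degenerate) triangle. -/
lemma exists_circle_triangle {a b c : ℝ} (ha : 0 ≤ a)
    (h₁ : a ≤ b + c) (h₂ : b ≤ a + c) (h₃ : c ≤ a + b) :
    ∃ u v w : Circle, (a : ℂ) * u + b * v + c * w = 0 := by
  have hcont : Continuous fun θ : ℝ => ‖(b : ℂ) + c * Circle.exp θ‖ := by fun_prop
  -- As the angle between the sides `b` and `c` varies, the third side runs from `|b - c|` to `b +
  -- c`; the intermediate value theorem produces `a`.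
  have hmem : a ∈ Icc ‖(b : ℂ) + c * Circle.exp Real.pi‖ ‖(b : ℂ) + c * Circle.exp 0‖ := by
    have e1 : (b : ℂ) + c * Circle.exp Real.pi = ((b - c : ℝ) : ℂ) := by
      simp [Circle.coe_exp]; ring
    have e2 : (b : ℂ) + c * Circle.exp 0 = ((b + c : ℝ) : ℂ) := by simp
    rw [e1, e2, Complex.norm_real, Complex.norm_real, Real.norm_eq_abs, Real.norm_eq_abs]
    exact ⟨abs_le.2 ⟨by linarith, by linarith⟩, h₁.trans (le_abs_self _)⟩
  obtain ⟨θ, -, hθ⟩ := intermediate_value_uIcc (f := fun θ : ℝ => ‖(b : ℂ) + c * Circle.exp θ‖)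
    (a := Real.pi) (b := 0) hcont.continuousOn (Icc_subset_uIcc hmem)
  simp only at hθ
  rcases ha.eq_or_lt with rfl | ha'
  · exact ⟨1, 1, Circle.exp θ, by simpa using hθ⟩
  · have hz : ‖-((b : ℂ) + c * Circle.exp θ) / a‖ = 1 := by
      rw [norm_div, norm_neg, hθ, Complex.norm_real, Real.norm_of_nonneg ha, div_self ha'.ne']
    refine ⟨⟨-((b : ℂ) + c * Circle.exp θ) / a, mem_sphere_zero_iff_norm.2 hz⟩, 1, Circle.exp θ, ?_⟩
    have : (a : ℂ) ≠ 0 := by exact_mod_cast ha'.ne'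
    simp only [Circle.coe_one]
    field_simp
    ring

/-- Uniform variables on `[0, y₁], [0, y₂], [0, y₃]` can be coupled with constant sum if the lengths
satisfy the triangle inequality. -/
lemma box_mean_le (f : ℝ → ℝ) (hf : Continuous f) {A c : ℝ}
    (h : ∀ x ∈ Icc (0 : ℝ) 1, ∀ y ∈ Icc (0 : ℝ) 1, ∀ z ∈ Icc (0 : ℝ) 1, x + y + z = c →
      A ≤ f x + f y + f z) {y₁ y₂ y₃ : ℝ} (h₁ : y₁ ∈ Icc (0 : ℝ) 1) (h₂ : y₂ ∈ Icc (0 : ℝ) 1)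
    (h₃ : y₃ ∈ Icc (0 : ℝ) 1) (hc₁ : y₁ ≤ c) (hc₂ : y₂ ≤ c) (hc₃ : y₃ ≤ c)
    (hs : y₁ + y₂ + y₃ = 2 * c) :
    A ≤ (∫ u in (0 : ℝ)..1, f (y₁ * u)) + (∫ u in (0 : ℝ)..1, f (y₂ * u)) +
      ∫ u in (0 : ℝ)..1, f (y₃ * u) := by
  -- Since `y₁ + y₂ + y₃ = 2 c`, the bounds `yᵢ ≤ c` are the triangle inequalities. The relation `∑
  -- yᵢ wᵢ = 0` makes the uniform variables `Re (wᵢ z)`, weighted by the `yᵢ`, sum to zero.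
  obtain ⟨w₁, w₂, w₃, hw⟩ := exists_circle_triangle (b := y₂) (c := y₃) h₁.1 (by linarith) (by linarith)
    (by linarith)
  have hmean : ∀ (w : Circle) (y : ℝ), ∫ u in (0 : ℝ)..1, f (y * u) =
      ∫ z, f (y * ((((w : ℂ) * z).re + 1) / 2)) ∂sphereProjection := by
    intro w y
    rw [integral_re_mul_sphereProjection w (fun t => f (y * ((t + 1) / 2))) (by fun_prop)]
    have e := mul_integral_comp_mul_add (a := -1) (b := 1) (f := fun u => f (y * u)) 2⁻¹ 2⁻¹
    norm_num at e
    rw [← e]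
    norm_num
    congr 1 with x
    congr 1
    ring
  have hint : ∀ (w : Circle) (y : ℝ),
      Integrable (fun z => f (y * ((((w : ℂ) * z).re + 1) / 2))) sphereProjection := fun w y =>
    integrable_re_mul_sphereProjection w (fun t => f (y * ((t + 1) / 2))) (by fun_prop)
  have hint₂ : Integrable (fun z => f (y₁ * ((((w₁ : ℂ) * z).re + 1) / 2)) +
      f (y₂ * ((((w₂ : ℂ) * z).re + 1) / 2))) sphereProjection := (hint _ _).add (hint _ _)
  rw [hmean w₁ y₁, hmean w₂ y₂, hmean w₃ y₃, ← MeasureTheory.integral_add (hint w₁ y₁) (hint w₂ y₂),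
    ← MeasureTheory.integral_add hint₂ (hint w₃ y₃)]
  have hA : A = ∫ _, A ∂sphereProjection := by simp
  rw [hA]
  refine integral_mono_ae (integrable_const _) (hint₂.add (hint _ _)) ?_
  filter_upwards [ae_re_mul_mem_Icc w₁, ae_re_mul_mem_Icc w₂, ae_re_mul_mem_Icc w₃] with z m₁ m₂ m₃
  have hre : y₁ * ((w₁ : ℂ) * z).re + y₂ * ((w₂ : ℂ) * z).re + y₃ * ((w₃ : ℂ) * z).re = 0 := by
    have := congrArg (fun t => (t * z).re) hw
    simp only [zero_mul, Complex.zero_re] at this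
    rw [← this]
    simp only [Complex.mul_re, Complex.add_re, Complex.add_im, Complex.ofReal_re, Complex.mul_im,
      Complex.ofReal_im]
    ring
  refine h _ ⟨?_, ?_⟩ _ ⟨?_, ?_⟩ _ ⟨?_, ?_⟩ ?_
  · exact mul_nonneg h₁.1 (by linarith [m₁.1])
  · exact mul_le_one₀ h₁.2 (by linarith [m₁.1]) (by linarith [m₁.2])
  · exact mul_nonneg h₂.1 (by linarith [m₂.1])
  · exact mul_le_one₀ h₂.2 (by linarith [m₂.1]) (by linarith [m₂.2])
  · exact mul_nonneg h₃.1 (by linarith [m₃.1])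
  · exact mul_le_one₀ h₃.2 (by linarith [m₃.1]) (by linarith [m₃.2])
  · linarith

/-! ### The dual inequality for two atoms. -/

/-- Coupling three copies of the decreasing density `x ↦ ℙ(x < Y)` with constant sum, where `Y` is
uniform on `[p - ρ, p + ρ]`. -/
lemma threshold_le (f : ℝ → ℝ) (hf : Continuous f) {A c p ρ : ℝ}
    (h : ∀ x ∈ Icc (0 : ℝ) 1, ∀ y ∈ Icc (0 : ℝ) 1, ∀ z ∈ Icc (0 : ℝ) 1, x + y + z = c →
      A ≤ f x + f y + f z) (hp : 0 < p) (hρ : 0 ≤ ρ) (hρp : ρ ≤ p) (h1 : p + ρ ≤ 1)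
    (hc : p + ρ ≤ c) (hcp : 2 * c * p = 3 * p ^ 2 + ρ ^ 2) :
    p * A ≤ 3 * ∫ u in (0 : ℝ)..1, ∫ t in (0 : ℝ)..(2 * ρ * u + (p - ρ)), f t := by
  have hF := continuous_primitive_of_continuous f hf 0
  have hM : Continuous fun y : ℝ => ∫ u in (0 : ℝ)..1, f (y * u) := by
    apply continuous_parametric_intervalIntegral_of_continuous' (by fun_prop)
  have hr : ρ / (2 * p) ≤ 1 / 2 := by
    rw [div_le_iff₀ (by positivity)]; linarith
  have hr0 : 0 ≤ ρ / (2 * p) := by positivity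
  have hY : ∀ u ∈ Icc (0 : ℝ) 1, 2 * ρ * u + (p - ρ) ∈ Icc (0 : ℝ) 1 ∧
      2 * ρ * u + (p - ρ) ≤ c := by
    intro u hu
    have := mul_nonneg hρ hu.1
    have := mul_nonneg hρ (sub_nonneg.2 hu.2)
    refine ⟨⟨?_, ?_⟩, ?_⟩ <;> linarith
  -- Random lengths `Y = 2 ρ U + (p - ρ)` are drawn with `U` of linear density and constant sum,
  -- chosen so that the three lengths add up to `2 c`; given them, `box_mean_le` applies.
  have key := linear_density (fun u => ∫ v in (0 : ℝ)..1, f ((2 * ρ * u + (p - ρ)) * v))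
    (hM.comp (by fun_prop : Continuous fun u : ℝ => 2 * ρ * u + (p - ρ)))
    (A := A) (c := 3 / 2 + ρ / (2 * p)) (by linarith) (by linarith) (by
      intro x hx y hy z hz hs
      refine box_mean_le f hf h (hY x hx).1 (hY y hy).1 (hY z hz).1 (hY x hx).2 (hY y hy).2
        (hY z hz).2 ?_
      have e : 2 * ρ * (x + y + z) + 3 * (p - ρ) = 2 * c := by
        rw [hs]; field_simp; linarith
      linarith)
  -- The linear density of `U` is exactly `Y / p`. This size bias cancels the factor `1 / Y` of the
  -- uniform density on `[0, Y]`.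
  have e : ∀ u : ℝ, (∫ v in (0 : ℝ)..1, f ((2 * ρ * u + (p - ρ)) * v)) *
      (4 - 2 * (3 / 2 + ρ / (2 * p)) + (4 * (3 / 2 + ρ / (2 * p)) - 6) * u) =
      p⁻¹ * ∫ t in (0 : ℝ)..(2 * ρ * u + (p - ρ)), f t := by
    intro u
    have := mul_integral_comp_mul_left (a := 0) (b := 1) (f := f) (2 * ρ * u + (p - ρ))
    rw [mul_zero, mul_one] at this
    rw [← this]
    field_simp
    ring
  simp only [e, intervalIntegral.integral_const_mul] at key
  have := mul_le_mul_of_nonneg_left key hp.le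
  calc p * A ≤ _ := this
    _ = _ := by field_simp

lemma forall_reflect {f : ℝ → ℝ} {A c : ℝ}
    (h : ∀ x ∈ Icc (0 : ℝ) 1, ∀ y ∈ Icc (0 : ℝ) 1, ∀ z ∈ Icc (0 : ℝ) 1, x + y + z = c →
      A ≤ f x + f y + f z) :
    ∀ x ∈ Icc (0 : ℝ) 1, ∀ y ∈ Icc (0 : ℝ) 1, ∀ z ∈ Icc (0 : ℝ) 1, x + y + z = 3 - c →
      A ≤ f (1 - x) + f (1 - y) + f (1 - z) := by
  intro x hx y hy z hz hs
  refine h _ ⟨?_, ?_⟩ _ ⟨?_, ?_⟩ _ ⟨?_, ?_⟩ ?_ <;>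
    linarith [hx.1, hx.2, hy.1, hy.2, hz.1, hz.2]

/-- The two-point case when both values of the sum lie outside `(1, 2)`. -/
lemma two_point_outer (f : ℝ → ℝ) (hf : Continuous f) {A B p q d : ℝ} (hp : 0 < p) (hq : 0 < q)
    (hpq : p + q = 1) (hd : d ≤ 3 / 2) (h1 : 3 / 2 - q * d ≤ 1) (h2 : 2 ≤ 3 / 2 + p * d)
    (hA : ∀ x ∈ Icc (0 : ℝ) 1, ∀ y ∈ Icc (0 : ℝ) 1, ∀ z ∈ Icc (0 : ℝ) 1,
      x + y + z = 3 / 2 - q * d → A ≤ f x + f y + f z)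
    (hB : ∀ x ∈ Icc (0 : ℝ) 1, ∀ y ∈ Icc (0 : ℝ) 1, ∀ z ∈ Icc (0 : ℝ) 1,
      x + y + z = 3 / 2 + p * d → B ≤ f x + f y + f z) :
    p * A + q * B ≤ 3 * ∫ x in (0 : ℝ)..1, f x := by
  obtain rfl : p = 1 - q := by linarith
  have hpos : 0 ≤ (1 - q) * q * (3 - 2 * d) := by
    apply mul_nonneg (mul_nonneg hp.le hq.le); linarith
  -- The solution of `2 c p = 3 p² + ρ²` for `c = 3 / 2 - q d`. The reflected equation for `q` has
  -- the same solution, so the thresholds `Y` on the two sides are reflections of each other and the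
  -- two densities add up to `1`.
  set ρ := √((1 - q) * q * (3 - 2 * d)) with hρ
  have hρ2 : ρ ^ 2 = (1 - q) * q * (3 - 2 * d) := Real.sq_sqrt hpos
  have hρ0 : 0 ≤ ρ := Real.sqrt_nonneg _
  have hd1 : 1 ≤ d := by linarith
  have b1 : q * (3 - 2 * d) ≤ 1 - q := by
    nlinarith [sq_nonneg (d - 1), mul_nonneg (sub_nonneg.2 hd1) hq.le]
  have b2 : (1 - q) * (3 - 2 * d) ≤ q := by
    nlinarith [sq_nonneg (d - 1), mul_nonneg (sub_nonneg.2 hd1) hp.le]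
  have hρp : ρ ≤ 1 - q := abs_le_of_sq_le_sq' (by nlinarith) hp.le |>.2
  have hρq : ρ ≤ q := abs_le_of_sq_le_sq' (by nlinarith) hq.le |>.2
  have hρc1 : ρ ≤ 3 / 2 - q * d - (1 - q) := by
    refine abs_le_of_sq_le_sq' ?_ ?_ |>.2
    -- The right side is `u + v` with `u = p / 2`, `v = 3 q (1 - 2 d / 3) / 2`, and `ρ² = 4 u v`, so
    -- this is the inequality `4 u v ≤ (u + v)²`.
    · rw [hρ2]; nlinarith [sq_nonneg ((1 - q) / 2 - 3 * q * (1 - 2 * d / 3) / 2)]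
    · nlinarith [mul_nonneg hq.le (sub_nonneg.2 hd)]
  have hρc2 : ρ ≤ 3 - (3 / 2 + (1 - q) * d) - q := by
    refine abs_le_of_sq_le_sq' ?_ ?_ |>.2
    · rw [hρ2]; nlinarith [sq_nonneg (q / 2 - 3 * (1 - q) * (1 - 2 * d / 3) / 2)]
    · nlinarith [mul_nonneg hp.le (sub_nonneg.2 hd)]
  have t1 := threshold_le f hf hA hp hρ0 hρp (by linarith) (by linarith) (by rw [hρ2]; ring)
  have t2 := threshold_le (fun x => f (1 - x)) (by fun_prop) (forall_reflect hB) hq hρ0 hρq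
    (by linarith) (by linarith) (by rw [hρ2]; ring)
  obtain ⟨F, hF, -, hFsub⟩ := exists_primitive f hf
  have e : ∀ u : ℝ, ∫ t in (0 : ℝ)..(2 * ρ * u + (q - ρ)), f (1 - t) =
      F 1 - F (2 * ρ * (1 - u) + (1 - q - ρ)) := by
    intro u
    rw [integral_comp_sub_left, hFsub]
    congr 2 <;> ring
  simp only [hFsub] at t1
  simp only [e] at t2
  have e2 := integral_comp_sub_left (a := 0) (b := 1)
    (fun u => F 1 - F (2 * ρ * u + (1 - q - ρ))) (1 : ℝ)
  simp only [sub_self, sub_zero] at e2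
  rw [e2] at t2
  rw [intervalIntegral.integral_sub (Continuous.intervalIntegrable (by fun_prop) _ _) (Continuous.intervalIntegrable (by fun_prop) _ _)]
    at t1 t2
  rw [hFsub]
  simp only [intervalIntegral.integral_const, smul_eq_mul] at t1 t2
  linarith

/-- The two-point case when both values of the sum lie in `[1, 2]`. -/
lemma two_point_inner (f : ℝ → ℝ) (hf : Continuous f) {A B p q d : ℝ} (hp : 0 ≤ p) (hq : 0 ≤ q)
    (hpq : p + q = 1) (hd : 0 ≤ d) (h1 : 1 ≤ 3 / 2 - q * d) (h2 : 3 / 2 + p * d ≤ 2)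
    (hA : ∀ x ∈ Icc (0 : ℝ) 1, ∀ y ∈ Icc (0 : ℝ) 1, ∀ z ∈ Icc (0 : ℝ) 1,
      x + y + z = 3 / 2 - q * d → A ≤ f x + f y + f z)
    (hB : ∀ x ∈ Icc (0 : ℝ) 1, ∀ y ∈ Icc (0 : ℝ) 1, ∀ z ∈ Icc (0 : ℝ) 1,
      x + y + z = 3 / 2 + p * d → B ≤ f x + f y + f z) :
    p * A + q * B ≤ 3 * ∫ x in (0 : ℝ)..1, f x := by
  have t1 := linear_density f hf h1 (by nlinarith) hA
  have t2 := linear_density f hf (by nlinarith) h2 hB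
  -- The linear density is affine in `c`, and the sums have mean `3 / 2`, where it equals `1`.
  have e : ∫ x in (0 : ℝ)..1, f x =
      p * (∫ x in (0 : ℝ)..1, f x * (4 - 2 * (3 / 2 - q * d) + (4 * (3 / 2 - q * d) - 6) * x)) +
      q * ∫ x in (0 : ℝ)..1, f x * (4 - 2 * (3 / 2 + p * d) + (4 * (3 / 2 + p * d) - 6) * x) := by
    rw [← intervalIntegral.integral_const_mul, ← intervalIntegral.integral_const_mul,
      ← intervalIntegral.integral_add]
    · congr 1 with x
      obtain rfl : p = 1 - q := by linarith
      ring
    all_goals exact Continuous.intervalIntegrable (by fun_prop) _ _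
  rw [e]
  nlinarith [mul_le_mul_of_nonneg_left t1 hp, mul_le_mul_of_nonneg_left t2 hq]

/-- The extreme two-point case. -/
lemma two_point_sharp (f : ℝ → ℝ) (hf : Continuous f) {A B p q : ℝ} (hp : 0 ≤ p) (hq : 0 ≤ q)
    (hpq : p + q = 1)
    (hA : ∀ x ∈ Icc (0 : ℝ) 1, ∀ y ∈ Icc (0 : ℝ) 1, ∀ z ∈ Icc (0 : ℝ) 1,
      x + y + z = 3 / 2 - q * (3 / 2) → A ≤ f x + f y + f z)
    (hB : ∀ x ∈ Icc (0 : ℝ) 1, ∀ y ∈ Icc (0 : ℝ) 1, ∀ z ∈ Icc (0 : ℝ) 1,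
      x + y + z = 3 / 2 + p * (3 / 2) → B ≤ f x + f y + f z) :
    p * A + q * B ≤ 3 * ∫ x in (0 : ℝ)..1, f x := by
  -- At `d = 3 / 2` the uniform law splits into the blocks `[0, p]` and `[p, 1]`, each coupled with
  -- its own constant sum.
  have t1 := uniform_block f hf hp (A := A) fun x hx y hy z hz hs =>
    hA x ⟨hx.1, by linarith [hx.2]⟩ y ⟨hy.1, by linarith [hy.2]⟩ z ⟨hz.1, by linarith [hz.2]⟩
      (by rw [hs]; linarith)
  have t2 := uniform_block f hf (a := p) (b := 1) (by linarith) (A := B) fun x hx y hy z hz hs =>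
    hB x ⟨by linarith [hx.1], hx.2⟩ y ⟨by linarith [hy.1], hy.2⟩ z ⟨by linarith [hz.1], hz.2⟩
      (by rw [hs]; linarith)
  rw [← integral_add_adjacent_intervals (hf.intervalIntegrable 0 p) (hf.intervalIntegrable p 1)]
  obtain rfl : q = 1 - p := by linarith
  linarith

/-- Peeling off hexagon boundaries: the part of the uniform distribution outside `[a L, b L]`. -/
lemma peel (f : ℝ → ℝ) (hf : Continuous f) {A γ M : ℝ} (hγ : 0 ≤ γ) (hM0 : 0 < M) (hM1 : M ≤ 1)
    (hM : 2 * γ ≤ M ^ 4)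
    (hA : ∀ x ∈ Icc (0 : ℝ) 1, ∀ y ∈ Icc (0 : ℝ) 1, ∀ z ∈ Icc (0 : ℝ) 1,
      x + y + z = 3 / 2 - γ → A ≤ f x + f y + f z) :
    ∃ a : ℝ, 3 * a = 3 / 2 - γ - 3 * M / 2 + γ / M ^ 3 ∧ 0 ≤ a ∧ a + M ≤ 1 ∧
      A * (1 - M ^ 3) + 3 * M ^ 2 * (∫ x in a..(a + M), f x) ≤ 3 * ∫ x in (0 : ℝ)..1, f x := by
  obtain ⟨F, hF, hFf, hFsub⟩ := exists_primitive f hf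
  -- After peeling, a uniform law of mass `L ^ 3` on `[a L, a L + L]` remains. Conservation of the
  -- mean determines `a L`, the removed triples all having sum `3 / 2 - γ`.
  set a : ℝ → ℝ := fun L => (3 / 2 - γ - 3 * L / 2 + γ / L ^ 3) / 3 with ha
  have hbounds : ∀ L ∈ Icc M 1, 0 ≤ a L ∧ a L + L ≤ 1 := by
    intro L hL
    have hL0 : 0 < L := hM0.trans_le hL.1
    have h4 : 2 * γ ≤ L ^ 4 := hM.trans (pow_le_pow_left₀ hM0.le hL.1 4)
    have i1 : 1 ≤ 1 / L ^ 3 := by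
      rw [le_div_iff₀ (by positivity), one_mul]; exact pow_le_one₀ hL0.le hL.2
    have i2 : γ / L ^ 3 = γ * (1 / L ^ 3) := by ring
    constructor
    · simp only [ha]
      rw [i2]
      have := mul_le_mul_of_nonneg_left i1 hγ
      have := hL.2
      apply div_nonneg _ (by norm_num)
      linarith
    · simp only [ha]
      have i3 : γ / L ^ 3 - γ ≤ 3 / 2 * (1 - L) := by
        have : γ / L ^ 3 - γ = γ * (1 - L ^ 3) / L ^ 3 := by field_simp
        rw [this, div_le_iff₀ (by positivity)]
        have h5 : 0 ≤ 1 - L ^ 3 := sub_nonneg.2 (pow_le_one₀ hL0.le hL.2)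
        have h6 : γ * (1 - L ^ 3) ≤ L ^ 4 / 2 * (1 - L ^ 3) :=
          mul_le_mul_of_nonneg_right (by linarith) h5
        have h7 : L ^ 4 / 2 * (1 - L ^ 3) = (1 - L) * L ^ 3 * (L * (1 + L + L ^ 2) / 2) := by ring
        have h8 : L * (1 + L + L ^ 2) / 2 ≤ 3 / 2 := by nlinarith [hL.2, pow_le_one₀ hL0.le hL.2 (n := 2), pow_le_one₀ hL0.le hL.2 (n := 3)]
        have h9 : 0 ≤ (1 - L) * L ^ 3 := mul_nonneg (sub_nonneg.2 hL.2) (by positivity)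
        nlinarith [mul_le_mul_of_nonneg_left h8 h9]
      linarith
  have hder : ∀ L ∈ Icc M 1, HasDerivAt (fun L => 3 * L ^ 2 * (F (a L + L) - F (a L)) - A * L ^ 3)
      (3 * (2 * L * (F (a L + L) - F (a L)) + (L ^ 2 / 2 - γ / L ^ 2) * f (a L + L) +
        (L ^ 2 / 2 + γ / L ^ 2) * f (a L)) - 3 * A * L ^ 2) L := by
    intro L hL
    have hL0 : L ≠ 0 := (hM0.trans_le hL.1).ne'
    have da : HasDerivAt a (-1 / 2 - γ / L ^ 4) L := by
      have h1 := ((((hasDerivAt_id L).const_mul 3).div_const 2).const_sub (3 / 2 - γ)).add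
        ((hasDerivAt_const L γ).div (hasDerivAt_pow 3 L) (pow_ne_zero 3 hL0))
      convert! h1.div_const 3 using 1
      field_simp
      simp
      ring
    have dab : HasDerivAt (fun L => a L + L) (-1 / 2 - γ / L ^ 4 + 1) L := da.add (hasDerivAt_id L)
    have hb := HasDerivAt.comp (h := fun L => a L + L) L (hFf (a L + L)) dab
    have ha' := (hFf (a L)).comp L da
    have h3 := ((((hasDerivAt_pow 2 L).const_mul 3).mul (hb.sub ha'))).sub
      ((hasDerivAt_pow 3 L).const_mul A)
    convert! h3 using 1
    simp [Function.comp]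
    field_simp
    ring
  -- The derivative is controlled by averaging over the edges of the hexagon cut from the cube `[a
  -- L, a L + L] ^ 3`. The offset of the plane from the centre of this cube is `γ / L ^ 3`, and `2 γ
  -- ≤ L ^ 4` keeps the edges inside it.
  have hmono : MonotoneOn (fun L => 3 * L ^ 2 * (F (a L + L) - F (a L)) - A * L ^ 3) (Icc M 1) := by
    refine monotoneOn_of_deriv_nonneg (convex_Icc _ _)
      (fun L hL => (hder L hL).continuousAt.continuousWithinAt)
      (fun L hL => (hder L (interior_subset hL)).differentiableAt.differentiableWithinAt) ?_
    intro L hL'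
    have hL := interior_subset hL'
    rw [(hder L hL).deriv]
    have hL0 : 0 < L := hM0.trans_le hL.1
    have h4 : 2 * γ ≤ L ^ 4 := hM.trans (pow_le_pow_left₀ hM0.le hL.1 4)
    obtain ⟨ba, bb⟩ := hbounds L hL
    have h3a : 3 * a L = 3 / 2 - γ - 3 * L / 2 + γ / L ^ 3 := by simp only [ha]; ring
    set κ := γ / L ^ 3 with hκ
    have hκ0 : 0 ≤ κ := by positivity
    have hκL : κ ≤ L / 2 := by
      rw [hκ, div_le_iff₀ (by positivity)]; nlinarith
    -- the sum is `3 a + 3 L / 2 - κ`; the two faces through `a` and `a + L`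
    have f1 := edge_le f hf (A := A) (t := a L) (l := a L + L / 2 - κ) (r := a L + L)
      (by linarith) (by
        intro x hx
        refine hA _ ⟨?_, ?_⟩ _ ⟨?_, ?_⟩ _ ⟨?_, ?_⟩ ?_ <;> linarith [hx.1, hx.2])
    have f2 := edge_le f hf (A := A) (t := a L + L) (l := a L) (r := a L + L / 2 - κ)
      (by linarith) (by
        intro x hx
        refine hA _ ⟨?_, ?_⟩ _ ⟨?_, ?_⟩ _ ⟨?_, ?_⟩ ?_ <;> linarith [hx.1, hx.2])
    rw [hFsub] at f1 f2
    have e1 : γ / L ^ 2 = κ * L := by rw [hκ]; field_simp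
    rw [e1]
    nlinarith [mul_le_mul_of_nonneg_left (add_le_add f1 f2) hL0.le]
  have hfin := hmono ⟨le_rfl, hM1⟩ ⟨hM1, le_rfl⟩ hM1
  have ha1 : a 1 = 0 := by simp only [ha]; norm_num
  simp only [ha1] at hfin
  refine ⟨a M, by simp only [ha]; ring, (hbounds M ⟨le_rfl, hM1⟩).1, (hbounds M ⟨le_rfl, hM1⟩).2, ?_⟩
  rw [hFsub, hFsub]
  norm_num at hfin
  linarith

/-- The two-point case when both values of the sum are at least `1` and `2`, respectively. -/
lemma two_point_upper (f : ℝ → ℝ) (hf : Continuous f) {A B p q d : ℝ} (hp : 0 < p) (hq : 0 < q)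
    (hpq : p + q = 1) (hd : d ≤ 3 / 2) (h1 : 1 ≤ 3 / 2 - q * d) (h2 : 2 ≤ 3 / 2 + p * d)
    (hA : ∀ x ∈ Icc (0 : ℝ) 1, ∀ y ∈ Icc (0 : ℝ) 1, ∀ z ∈ Icc (0 : ℝ) 1,
      x + y + z = 3 / 2 - q * d → A ≤ f x + f y + f z)
    (hB : ∀ x ∈ Icc (0 : ℝ) 1, ∀ y ∈ Icc (0 : ℝ) 1, ∀ z ∈ Icc (0 : ℝ) 1,
      x + y + z = 3 / 2 + p * d → B ≤ f x + f y + f z) :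
    p * A + q * B ≤ 3 * ∫ x in (0 : ℝ)..1, f x := by
  obtain rfl : p = 1 - q := by linarith
  have hd2 : 1 / 2 ≤ d := by nlinarith
  set γ := q * d with hγ
  have hγ0 : 0 < γ := by positivity
  set r := √(√(2 * γ)) with hr
  have hr0 : 0 ≤ r := Real.sqrt_nonneg _
  have hr4 : r ^ 4 = 2 * γ := by
    have : r ^ 4 = (r ^ 2) ^ 2 := by ring
    rw [this, hr, Real.sq_sqrt (Real.sqrt_nonneg _), Real.sq_sqrt (by positivity)]
  have hr1 : r ≤ 1 := by
    rw [← pow_le_one_iff_of_nonneg hr0 (n := 4) (by norm_num), hr4]; linarith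
  -- Peeling down to length `M` rescales `d` to `d / M` and `q` to `q / M ^ 3`. It stops when either
  -- the rescaled distance reaches `3 / 2`, the sharp case, or the rescaled lower sum reaches `1`,
  -- where the inner or outer case applies.
  obtain ⟨M, hM0, hM1, hrM, hdM, hcase⟩ : ∃ M : ℝ, 0 < M ∧ M ≤ 1 ∧ r ≤ M ∧ 2 * d / 3 ≤ M ∧
      (M = r ∨ M = 2 * d / 3) := by
    refine ⟨max r (2 * d / 3), lt_max_of_lt_right (by linarith), max_le hr1 (by linarith),
      le_max_left _ _, le_max_right _ _, max_choice _ _⟩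
  have hM4 : 2 * γ ≤ M ^ 4 := hr4 ▸ pow_le_pow_left₀ hr0 hrM 4
  obtain ⟨a, ha3, ha0, haM, hpeel⟩ := peel f hf hγ0.le hM0 hM1 hM4 hA
  set d' := d / M with hd'
  set q' := q / M ^ 3 with hq'
  have hd'3 : d' ≤ 3 / 2 := by rw [hd', div_le_iff₀ hM0]; linarith
  have hd'0 : 0 < d' := by positivity
  have hq'0 : 0 < q' := by positivity
  have hqd' : q' * d' = γ / M ^ 4 := by rw [hq', hd', hγ]; field_simp
  have hqd'2 : q' * d' ≤ 1 / 2 := by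
    rw [hqd', div_le_iff₀ (by positivity)]; linarith
  have hMd : M * d' = d := by rw [hd']; field_simp
  have hMq : M * (q' * d') = γ / M ^ 3 := by rw [hqd']; field_simp
  have hd'half : 1 / 2 ≤ d' := by linarith [mul_le_of_le_one_left hd'0.le hM1]
  have hq'1 : q' ≤ 1 := le_of_mul_le_mul_right (by linarith : q' * d' ≤ 1 * d') hd'0
  have hbd : ∀ x ∈ Icc (0 : ℝ) 1, M * x + a ∈ Icc (0 : ℝ) 1 := by
    intro x hx
    have := mul_nonneg hM0.le hx.1
    have := mul_le_of_le_one_right hM0.le hx.2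
    constructor <;> linarith
  have hA' : ∀ x ∈ Icc (0 : ℝ) 1, ∀ y ∈ Icc (0 : ℝ) 1, ∀ z ∈ Icc (0 : ℝ) 1,
      x + y + z = 3 / 2 - q' * d' → A ≤ f (M * x + a) + f (M * y + a) + f (M * z + a) := by
    intro x hx y hy z hz hs
    refine hA _ (hbd x hx) _ (hbd y hy) _ (hbd z hz) ?_
    linear_combination M * hs + ha3 - hMq
  have hB' : ∀ x ∈ Icc (0 : ℝ) 1, ∀ y ∈ Icc (0 : ℝ) 1, ∀ z ∈ Icc (0 : ℝ) 1,
      x + y + z = 3 / 2 + (1 - q') * d' → B ≤ f (M * x + a) + f (M * y + a) + f (M * z + a) := by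
    intro x hx y hy z hz hs
    refine hB _ (hbd x hx) _ (hbd y hy) _ (hbd z hz) ?_
    rw [sub_mul, one_mul, ← hγ]
    linear_combination M * hs + ha3 - hMq + hMd
  have hsmall : (1 - q') * A + q' * B ≤ 3 * ∫ x in (0 : ℝ)..1, f (M * x + a) := by
    by_cases hsharp : d' = 3 / 2
    · rw [hsharp] at hA' hB'
      exact two_point_sharp _ (by fun_prop) (by linarith) hq'0.le (by ring) hA' hB'
    · have hMr : M = r := by
        rcases hcase with h | h
        · exact h
        · exfalso; apply hsharp
          rw [hd', h]; field_simp
      have hone : q' * d' = 1 / 2 := by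
        rw [hqd', hMr, hr4]; field_simp
      rcases le_total (3 / 2 + (1 - q') * d') 2 with h | h
      · exact two_point_inner _ (by fun_prop) (by linarith) hq'0.le (by ring) hd'0.le
          (by linarith) h hA' hB'
      · exact two_point_outer _ (by fun_prop) ((mul_pos_iff_of_pos_right hd'0).1 (by linarith)) hq'0 (by ring) hd'3
          (by linarith) h hA' hB'
  have e := mul_integral_comp_mul_add (a := 0) (b := 1) (f := f) M a
  rw [mul_zero, zero_add, mul_one, add_comm M a] at e
  rw [← e] at hpeel
  have hq3 : M ^ 3 * q' = q := by rw [hq']; field_simp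
  have := mul_le_mul_of_nonneg_left hsmall (show 0 ≤ M ^ 3 by positivity)
  have e5 : M ^ 3 * ((1 - q') * A + q' * B) = M ^ 3 * A - q * A + q * B := by
    rw [← hq3]; ring
  rw [e5] at this
  linarith

/-- If `f x + f y + f z` is at least `A`, `B` on two parallel planes at distance at most `3 / 2`,
then the mean of `3 f` is at least the corresponding mean of `A` and `B`. -/
lemma two_point (f : ℝ → ℝ) (hf : Continuous f) {A B p q d : ℝ} (hp : 0 < p) (hq : 0 < q)
    (hpq : p + q = 1) (hd0 : 0 ≤ d) (hd : d ≤ 3 / 2)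
    (hA : ∀ x ∈ Icc (0 : ℝ) 1, ∀ y ∈ Icc (0 : ℝ) 1, ∀ z ∈ Icc (0 : ℝ) 1,
      x + y + z = 3 / 2 - q * d → A ≤ f x + f y + f z)
    (hB : ∀ x ∈ Icc (0 : ℝ) 1, ∀ y ∈ Icc (0 : ℝ) 1, ∀ z ∈ Icc (0 : ℝ) 1,
      x + y + z = 3 / 2 + p * d → B ≤ f x + f y + f z) :
    p * A + q * B ≤ 3 * ∫ x in (0 : ℝ)..1, f x := by
  rcases le_total 1 (3 / 2 - q * d) with h1 | h1 <;> rcases le_total 2 (3 / 2 + p * d) with h2 | h2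
  · exact two_point_upper f hf hp hq hpq hd h1 h2 hA hB
  · exact two_point_inner f hf hp.le hq.le hpq hd0 h1 h2 hA hB
  · exact two_point_outer f hf hp hq hpq hd h1 h2 hA hB
  -- Reflection exchanges the two planes and the roles of `p` and `q`.
  · have hA' := forall_reflect hA
    have hB' := forall_reflect hB
    have e1 : 3 - (3 / 2 - q * d) = 3 / 2 + q * d := by ring
    have e2 : 3 - (3 / 2 + p * d) = 3 / 2 - p * d := by ring
    rw [e1] at hA'
    rw [e2] at hB'
    have := two_point_upper (fun x => f (1 - x)) (by fun_prop) hq hp (by linarith) hd (by linarith)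
      (by linarith) hB' hA'
    rw [integral_comp_sub_left] at this
    simp only [sub_self, sub_zero] at this
    linarith

/-! ### Finitely many atoms dominated by Lebesgue measure. -/

/-- The measure `∑ i ∈ S, m i • δ (s i)` has the same mass and mean as the Lebesgue measure on
`[a, b]` and is dominated by it in the convex order. -/
structure AtomsDominated (S : Finset ℕ) (m s : ℕ → ℝ) (a b : ℝ) : Prop where
  nonneg : ∀ i ∈ S, 0 ≤ m i
  mass : ∑ i ∈ S, m i = b - a
  moment : ∑ i ∈ S, m i * s i = (b ^ 2 - a ^ 2) / 2
  hinge : ∀ t ∈ Icc a b, ∑ i ∈ S, m i * max (s i - t) 0 ≤ (b - t) ^ 2 / 2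

namespace AtomsDominated

variable {S : Finset ℕ} {m s : ℕ → ℝ} {a b : ℝ}

lemma erase (h : AtomsDominated S m s a b) {i : ℕ} (hm : m i = 0) :
    AtomsDominated (S.erase i) m s a b where
  nonneg j hj := h.nonneg j (Finset.mem_of_mem_erase hj)
  mass := by rw [Finset.sum_erase _ hm, h.mass]
  moment := by rw [Finset.sum_erase _ (by simp [hm]), h.moment]
  hinge t ht := by rw [Finset.sum_erase _ (by simp [hm])]; exact h.hinge t ht

lemma le_length (h : AtomsDominated S m s a b) {i : ℕ} (hi : i ∈ S) : m i ≤ b - a :=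
  h.mass ▸ Finset.single_le_sum h.nonneg hi

/-- An atom of mass `m` at or beyond `b` would contribute at least `m²` to the hinge sum at `b - m`,
where only `m² / 2` is allowed. -/
lemma lt_right (h : AtomsDominated S m s a b) {i : ℕ} (hi : i ∈ S) (hm : 0 < m i) : s i < b := by
  by_contra! hs
  have h1 := h.hinge (b - m i) ⟨by linarith [h.le_length hi], by linarith⟩
  have h2 := Finset.single_le_sum (f := fun j => m j * max (s j - (b - m i)) 0)
    (fun j hj => mul_nonneg (h.nonneg j hj) (le_max_right _ _)) hi
  have h3 : m i * m i ≤ m i * max (s i - (b - m i)) 0 :=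
    mul_le_mul_of_nonneg_left (le_max_of_le_left (by linarith)) hm.le
  nlinarith

/-- The two hinges at `t` differ by an affine function, whose sum is fixed by mass and moment. -/
lemma hinge_left (h : AtomsDominated S m s a b) {t : ℝ} (ht : t ∈ Icc a b) :
    ∑ i ∈ S, m i * max (t - s i) 0 ≤ (t - a) ^ 2 / 2 := by
  have e : ∑ i ∈ S, m i * max (t - s i) 0 =
      ∑ i ∈ S, m i * max (s i - t) 0 - ∑ i ∈ S, m i * s i + t * ∑ i ∈ S, m i := by
    rw [Finset.mul_sum, ← Finset.sum_sub_distrib, ← Finset.sum_add_distrib]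
    refine Finset.sum_congr rfl fun i _ => ?_
    rcases le_total (s i) t with h | h
    · rw [max_eq_left (by linarith), max_eq_right (by linarith)]; ring
    · rw [max_eq_right (by linarith), max_eq_left (by linarith)]; ring
  rw [e, h.mass, h.moment]
  linarith [h.hinge t ht]

lemma left_lt (h : AtomsDominated S m s a b) {i : ℕ} (hi : i ∈ S) (hm : 0 < m i) : a < s i := by
  by_contra! hs
  have h1 := h.hinge_left (t := a + m i) ⟨by linarith, by linarith [h.le_length hi]⟩
  have h2 := Finset.single_le_sum (f := fun j => m j * max (a + m i - s j) 0)
    (fun j hj => mul_nonneg (h.nonneg j hj) (le_max_right _ _)) hi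
  have h3 : m i * m i ≤ m i * max (a + m i - s i) 0 :=
    mul_le_mul_of_nonneg_left (le_max_of_le_left (by linarith)) hm.le
  nlinarith

/-- Where the potential touches that of the Lebesgue measure, the problem splits. -/
lemma split (h : AtomsDominated S m s a b) {c : ℝ} (hac : a < c) (hcb : c < b)
    (hc : ∑ i ∈ S, m i * max (s i - c) 0 = (b - c) ^ 2 / 2) :
    AtomsDominated (S.filter fun i => ¬ c < s i) m s a c ∧
      AtomsDominated (S.filter fun i => c < s i) m s c b := by
  set P := ∑ i ∈ S.filter (fun i => c < s i), m i with hP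
  have hPS : P = ∑ i ∈ S, if c < s i then m i else 0 := by rw [hP, Finset.sum_filter]
  -- At a contact point, the hinge bounds just right and just left of `c` squeeze the one-sided
  -- slopes, which forces the mass above `c` to be `b - c`.
  have hP1 : b - c ≤ P := by
    refine le_of_forall_pos_le_add fun ε hε => ?_
    set δ := min ε (b - c) with hδ
    have hδ0 : 0 < δ := lt_min hε (by linarith)
    have h1 := h.hinge (c + δ) ⟨by linarith, by linarith [min_le_right ε (b - c)]⟩
    have h2 : ∑ i ∈ S, m i * max (s i - c) 0 - δ * P ≤ ∑ i ∈ S, m i * max (s i - (c + δ)) 0 := by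
      rw [hPS, Finset.mul_sum, ← Finset.sum_sub_distrib]
      refine Finset.sum_le_sum fun i hi => ?_
      have hm := h.nonneg i hi
      split_ifs with hcs
      · rw [max_eq_left (by linarith)]
        nlinarith [le_max_left (s i - (c + δ)) 0]
      · rw [max_eq_right (by linarith)]
        have := mul_nonneg hm (le_max_right (s i - (c + δ)) 0)
        linarith
    have h3 : δ * (b - c) ≤ δ * (P + δ) := by nlinarith
    have := le_of_mul_le_mul_left h3 hδ0
    linarith [min_le_left ε (b - c)]
  have hP2 : P ≤ b - c := by
    refine le_of_forall_pos_le_add fun ε hε => ?_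
    set δ := min ε (c - a) with hδ
    have hδ0 : 0 < δ := lt_min hε (by linarith)
    have h1 := h.hinge (c - δ) ⟨by linarith [min_le_right ε (c - a)], by linarith⟩
    have h2 : ∑ i ∈ S, m i * max (s i - c) 0 + δ * P ≤ ∑ i ∈ S, m i * max (s i - (c - δ)) 0 := by
      rw [hPS, Finset.mul_sum, ← Finset.sum_add_distrib]
      refine Finset.sum_le_sum fun i hi => ?_
      have hm := h.nonneg i hi
      split_ifs with hcs
      · rw [max_eq_left (by linarith)]
        nlinarith [le_max_left (s i - (c - δ)) 0]
      · rw [max_eq_right (by linarith)]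
        have := mul_nonneg hm (le_max_right (s i - (c - δ)) 0)
        linarith
    have h3 : δ * P ≤ δ * (b - c + δ) := by nlinarith
    have := le_of_mul_le_mul_left h3 hδ0
    linarith [min_le_left ε (c - a)]
  have hPe : P = b - c := le_antisymm hP2 hP1
  have hU : ∑ i ∈ S.filter (fun i => c < s i), m i * s i = (b ^ 2 - c ^ 2) / 2 := by
    have e : ∑ i ∈ S, m i * max (s i - c) 0 =
        ∑ i ∈ S.filter (fun i => c < s i), (m i * s i - m i * c) := by
      rw [Finset.sum_filter]
      refine Finset.sum_congr rfl fun i _ => ?_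
      split_ifs with hcs
      · rw [max_eq_left (by linarith)]; ring
      · rw [max_eq_right (by linarith)]; ring
    rw [Finset.sum_sub_distrib, ← Finset.sum_mul, ← hP, hPe, hc] at e
    linarith
  have hsplit : ∀ g : ℕ → ℝ, ∑ i ∈ S.filter (fun i => ¬ c < s i), g i =
      ∑ i ∈ S, g i - ∑ i ∈ S.filter (fun i => c < s i), g i := fun g => by
    rw [← Finset.sum_filter_add_sum_filter_not S (fun i => c < s i)]; ring
  refine ⟨⟨fun i hi => h.nonneg i (Finset.mem_filter.1 hi).1, ?_, ?_, ?_⟩,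
    ⟨fun i hi => h.nonneg i (Finset.mem_filter.1 hi).1, hPe, hU, ?_⟩⟩
  · rw [hsplit, h.mass, ← hP, hPe]; ring
  · rw [hsplit, h.moment, hU]; ring
  · intro t ht
    have e : ∑ i ∈ S.filter (fun i => c < s i), m i * max (s i - t) 0 =
        ∑ i ∈ S.filter (fun i => c < s i), (m i * s i - m i * t) := by
      refine Finset.sum_congr rfl fun i hi => ?_
      rw [max_eq_left (by linarith [(Finset.mem_filter.1 hi).2, ht.2])]; ring
    rw [hsplit, e, Finset.sum_sub_distrib, ← Finset.sum_mul, ← hP, hPe, hU]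
    linarith [h.hinge t ⟨ht.1, by linarith [ht.2]⟩]
  · intro t ht
    refine le_trans ?_ (h.hinge t ⟨by linarith [ht.1], ht.2⟩)
    exact Finset.sum_le_sum_of_subset_of_nonneg (Finset.filter_subset _ _)
      fun i hi _ => mul_nonneg (h.nonneg i hi) (le_max_right _ _)

end AtomsDominated

/-- Transfer of mass between three atoms, preserving mass and mean. -/
def spreadDir (i j k : ℕ) (l : ℝ) (x : ℕ) : ℝ :=
  (if x = i then l else 0) - (if x = j then 1 else 0) + (if x = k then 1 - l else 0)

lemma sum_spreadDir {S : Finset ℕ} {i j k : ℕ} (hi : i ∈ S) (hj : j ∈ S) (hk : k ∈ S) (l τ : ℝ)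
    (m g : ℕ → ℝ) :
    ∑ x ∈ S, (m x + τ * spreadDir i j k l x) * g x =
      ∑ x ∈ S, m x * g x + τ * (l * g i - g j + (1 - l) * g k) := by
  have e : ∀ x, (m x + τ * spreadDir i j k l x) * g x = m x * g x + τ *
      ((if x = i then l * g x else 0) - (if x = j then g x else 0) +
        (if x = k then (1 - l) * g x else 0)) := by
    intro x
    simp only [spreadDir]
    split_ifs <;> ring
  simp only [e, Finset.sum_add_distrib, ← Finset.mul_sum, Finset.sum_sub_distrib,
    Finset.sum_ite_eq', hi, hj, hk, if_true]

lemma spreadDir_left {i j k : ℕ} (hij : i ≠ j) (hik : i ≠ k) (l : ℝ) :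
    spreadDir i j k l i = l := by simp [spreadDir, hij, hik]

lemma spreadDir_mid {i j k : ℕ} (hij : i ≠ j) (hjk : j ≠ k) (l : ℝ) :
    spreadDir i j k l j = -1 := by simp [spreadDir, hij.symm, hjk]

lemma spreadDir_right {i j k : ℕ} (hik : i ≠ k) (hjk : j ≠ k) (l : ℝ) :
    spreadDir i j k l k = 1 - l := by simp [spreadDir, hik.symm, hjk.symm]

lemma spreadDir_of_ne {i j k x : ℕ} (hi : x ≠ i) (hj : x ≠ j) (hk : x ≠ k) (l : ℝ) :
    spreadDir i j k l x = 0 := by simp [spreadDir, hi, hj, hk]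

lemma AtomsDominated.spread {S : Finset ℕ} {m s : ℕ → ℝ} {a b : ℝ} (h : AtomsDominated S m s a b)
    {i j k : ℕ} (hi : i ∈ S) (hj : j ∈ S) (hk : k ∈ S) {l τ : ℝ}
    (hs : s j = l * s i + (1 - l) * s k)
    (hpos : ∀ x ∈ S, 0 ≤ m x + τ * spreadDir i j k l x)
    (hh : ∀ t ∈ Icc a b, ∑ x ∈ S, m x * max (s x - t) 0 + τ * (l * max (s i - t) 0 -
      max (s j - t) 0 + (1 - l) * max (s k - t) 0) ≤ (b - t) ^ 2 / 2) :
    AtomsDominated S (fun x => m x + τ * spreadDir i j k l x) s a b where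
  nonneg := hpos
  mass := by
    have := sum_spreadDir hi hj hk l τ m (fun _ => 1)
    simp only [mul_one] at this
    rw [this, h.mass]; ring
  moment := by
    rw [sum_spreadDir hi hj hk l τ m s, h.moment, hs]; ring
  hinge t ht := by
    rw [sum_spreadDir hi hj hk l τ m fun x => max (s x - t) 0]
    exact hh t ht

lemma max_sub_convex {l u v w : ℝ} (hl0 : 0 ≤ l) (hl1 : l ≤ 1) (hw : w = l * u + (1 - l) * v)
    (t : ℝ) : 0 ≤ l * max (u - t) 0 - max (w - t) 0 + (1 - l) * max (v - t) 0 := by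
  have : max (w - t) 0 ≤ l * max (u - t) 0 + (1 - l) * max (v - t) 0 := by
    apply max_le
    · nlinarith [mul_le_mul_of_nonneg_left (le_max_left (u - t) 0) hl0,
        mul_le_mul_of_nonneg_left (le_max_left (v - t) 0) (sub_nonneg.2 hl1)]
    · have := mul_nonneg hl0 (le_max_right (u - t) 0)
      have := mul_nonneg (sub_nonneg.2 hl1) (le_max_right (v - t) 0)
      linarith
  linarith

lemma exists_convex_weight {u v w : ℝ} (huw : u ≤ w) (hwv : w ≤ v) :
    ∃ l : ℝ, 0 ≤ l ∧ l ≤ 1 ∧ w = l * u + (1 - l) * v := by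
  have : w ∈ segment ℝ u v := by rw [segment_eq_Icc (huw.trans hwv)]; exact ⟨huw, hwv⟩
  obtain ⟨l, l', h0, h1, h2, h3⟩ := this
  exact ⟨l, h0, by linarith, by rw [← h3, ← h2]; simp⟩

/-- Spreading mass as far as possible either exhausts an atom or makes the potentials touch. -/
lemma AtomsDominated.exists_spread {S : Finset ℕ} {m s : ℕ → ℝ} {a b : ℝ}
    (h : AtomsDominated S m s a b) {i j k : ℕ} (hi : i ∈ S) (hj : j ∈ S) (hk : k ∈ S)
    (hij : i ≠ j) (hik : i ≠ k) (hjk : j ≠ k) (hpos : ∀ x ∈ S, 0 < m x)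
    (hsij : s i ≤ s j) (hsjk : s j ≤ s k) {l : ℝ} (hl0 : 0 ≤ l) (hl1 : l ≤ 1)
    (hs : s j = l * s i + (1 - l) * s k) :
    ∃ τ : ℝ, 0 ≤ τ ∧ AtomsDominated S (fun x => m x + τ * spreadDir i j k l x) s a b ∧
      (m j + τ * spreadDir i j k l j = 0 ∨ ∃ c, a < c ∧ c < b ∧
        ∑ x ∈ S, (m x + τ * spreadDir i j k l x) * max (s x - c) 0 = (b - c) ^ 2 / 2) := by
  set H : ℝ → ℝ := fun t => ∑ x ∈ S, m x * max (s x - t) 0 with hH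
  set κ : ℝ → ℝ := fun t => l * max (s i - t) 0 - max (s j - t) 0 + (1 - l) * max (s k - t) 0
    with hκ
  have hHc : Continuous H := by fun_prop
  have hκc : Continuous κ := by fun_prop
  have hκ0 : ∀ t, 0 ≤ κ t := max_sub_convex hl0 hl1 hs
  have hsum : ∀ τ t, ∑ x ∈ S, (m x + τ * spreadDir i j k l x) * max (s x - t) 0 = H t + τ * κ t :=
    fun τ t => sum_spreadDir hi hj hk l τ m fun x => max (s x - t) 0
  have hnn : ∀ τ ∈ Icc 0 (m j), ∀ x ∈ S, 0 ≤ m x + τ * spreadDir i j k l x := by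
    intro τ hτ x hx
    have hx0 := hpos x hx
    by_cases hxi : x = i
    · rw [hxi, spreadDir_left hij hik]
      have := mul_nonneg hτ.1 hl0
      have := hpos i hi
      linarith
    by_cases hxj : x = j
    · rw [hxj, spreadDir_mid hij hjk]; linarith [hτ.2]
    by_cases hxk : x = k
    · rw [hxk, spreadDir_right hik hjk]
      have := mul_nonneg hτ.1 (sub_nonneg.2 hl1)
      have := hpos k hk
      linarith
    · rw [spreadDir_of_ne hxi hxj hxk]; linarith
  -- Admissible amounts of spreading: the middle atom keeps nonnegative mass and the hinge bounds
  -- persist. The largest one is taken.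
  set T : Set ℝ := Icc 0 (m j) ∩ {τ | ∀ t ∈ Icc a b, H t + τ * κ t ≤ (b - t) ^ 2 / 2} with hT
  have hTc : IsCompact T := by
    refine isCompact_Icc.inter_right ?_
    simp only [Set.ofPred_forall]
    refine isClosed_iInter fun t => isClosed_iInter fun _ => isClosed_le ?_ ?_ <;> fun_prop
  have h0T : (0 : ℝ) ∈ T := ⟨⟨le_rfl, (hpos j hj).le⟩, fun t ht => by simpa using h.hinge t ht⟩
  obtain ⟨τ, ⟨hτI, hτH⟩, hmax⟩ := hTc.exists_isGreatest ⟨0, h0T⟩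
  have hdom := h.spread hi hj hk hs (hnn τ hτI) hτH
  refine ⟨τ, hτI.1, hdom, ?_⟩
  by_contra! hcon
  obtain ⟨hne, htouch⟩ := hcon
  rw [spreadDir_mid hij hjk] at hne
  have hτj : τ < m j := lt_of_le_of_ne hτI.2 fun e => hne (by rw [e]; ring)
  have hia : a < s i := h.left_lt hi (hpos i hi)
  have hkb : s k < b := h.lt_right hk (hpos k hk)
  obtain ⟨t₀, ht₀, hmin⟩ := isCompact_Icc.exists_isMinOn (s := Icc (s i) (s k))
    (f := fun t => (b - t) ^ 2 / 2 - (H t + τ * κ t)) ⟨s i, le_rfl, hsij.trans hsjk⟩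
    (by fun_prop)
  set δ := (b - t₀) ^ 2 / 2 - (H t₀ + τ * κ t₀) with hδ
  have hδ0 : 0 < δ := by
    have h1 := hτH t₀ ⟨by linarith [ht₀.1], by linarith [ht₀.2]⟩
    have h2 := htouch t₀ (by linarith [ht₀.1]) (by linarith [ht₀.2])
    rw [hsum] at h2
    have := lt_of_le_of_ne h1 h2
    rw [hδ]; linarith
  set ε := min (m j - τ) (δ / (s k - s i + 1)) with hε
  have hD : 0 < s k - s i + 1 := by linarith
  have hε0 : 0 < ε := lt_min (by linarith) (by positivity)
  -- `κ` vanishes outside `[s i, s k]`, and on this compact interval the slack is at least `δ > 0`,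
  -- so a little more spreading would be admissible.
  have : τ + ε ∈ T := by
    refine ⟨⟨by linarith [hτI.1], by linarith [min_le_left (m j - τ) (δ / (s k - s i + 1))]⟩, ?_⟩
    intro t ht
    by_cases htI : t ∈ Icc (s i) (s k)
    · have h1 : δ ≤ (b - t) ^ 2 / 2 - (H t + τ * κ t) := hmin htI
      have h2 : κ t ≤ s k - s i + 1 := by
        have e1 : max (s i - t) 0 = 0 := max_eq_right (by linarith [htI.1])
        have e2 : max (s k - t) 0 = s k - t := max_eq_left (by linarith [htI.2])
        simp only [hκ, e1, e2]
        have := le_max_right (s j - t) 0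
        have := mul_le_of_le_one_left (show 0 ≤ s k - t by linarith [htI.2])
          (show 1 - l ≤ 1 by linarith)
        linarith [htI.1]
      have h3 : ε * κ t ≤ δ := by
        calc ε * κ t ≤ δ / (s k - s i + 1) * (s k - s i + 1) :=
              mul_le_mul (min_le_right _ _) h2 (hκ0 t) (by positivity)
          _ = δ := by field_simp
      nlinarith
    · have h4 : κ t = 0 := by
        simp only [mem_Icc, not_and_or, not_le] at htI
        simp only [hκ]
        rcases htI with h5 | h5
        · rw [max_eq_left (by linarith), max_eq_left (by linarith), max_eq_left (by linarith), hs]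
          ring
        · rw [max_eq_right (by linarith), max_eq_right (by linarith), max_eq_right (by linarith)]
          ring
      have := hτH t ht
      rw [h4] at this ⊢
      linarith
  linarith [hmax this]

/-- Contracting mass as far as possible exhausts an atom. -/
lemma AtomsDominated.exists_contract {S : Finset ℕ} {m s : ℕ → ℝ} {a b : ℝ}
    (h : AtomsDominated S m s a b) {i j k : ℕ} (hi : i ∈ S) (hj : j ∈ S) (hk : k ∈ S)
    (hij : i ≠ j) (hik : i ≠ k) (hjk : j ≠ k) (hpos : ∀ x ∈ S, 0 < m x)
    {l : ℝ} (hl0 : 0 ≤ l) (hl1 : l ≤ 1) (hs : s j = l * s i + (1 - l) * s k) :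
    ∃ τ : ℝ, τ ≤ 0 ∧ AtomsDominated S (fun x => m x + τ * spreadDir i j k l x) s a b ∧
      ∃ x ∈ S, m x + τ * spreadDir i j k l x = 0 := by
  have hmi := hpos i hi
  have hmk := hpos k hk
  -- By convexity of the hinge, contracting only lowers the hinge sums; the sole constraint is the
  -- mass of the outer atoms.
  have main : ∀ τ : ℝ, τ ≤ 0 → 0 ≤ m i + τ * l → 0 ≤ m k + τ * (1 - l) →
      AtomsDominated S (fun x => m x + τ * spreadDir i j k l x) s a b := by
    intro τ hτ h1 h2
    refine h.spread hi hj hk hs ?_ ?_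
    · intro x hx
      have hx0 := hpos x hx
      by_cases hxi : x = i
      · rwa [hxi, spreadDir_left hij hik]
      by_cases hxj : x = j
      · rw [hxj, spreadDir_mid hij hjk]; linarith [hpos j hj]
      by_cases hxk : x = k
      · rwa [hxk, spreadDir_right hik hjk]
      · rw [spreadDir_of_ne hxi hxj hxk]; linarith
    · intro t ht
      have := mul_nonneg (neg_nonneg.2 hτ) (max_sub_convex hl0 hl1 hs t)
      linarith [h.hinge t ht]
  rcases le_total (m i * (1 - l)) (m k * l) with hc | hc
  · have hl : 0 < l := by
      rcases hl0.eq_or_lt with rfl | h0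
      · linarith
      · exact h0
    have e1 : m i + -(m i / l) * l = 0 := by field_simp; ring
    refine ⟨-(m i / l), by simp only [Left.neg_nonpos_iff]; positivity, main _
      (by simp only [Left.neg_nonpos_iff]; positivity) e1.ge ?_, i, hi, by
        rw [spreadDir_left hij hik, e1]⟩
    have : m i / l * (1 - l) ≤ m k := by
      rw [div_mul_eq_mul_div, div_le_iff₀ hl]; exact hc
    linarith
  · have hl : 0 < 1 - l := by
      rcases hl1.eq_or_lt with rfl | h0
      · linarith
      · linarith
    have e1 : m k + -(m k / (1 - l)) * (1 - l) = 0 := by field_simp; ring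
    refine ⟨-(m k / (1 - l)), by simp only [Left.neg_nonpos_iff]; positivity, main _
      (by simp only [Left.neg_nonpos_iff]; positivity) ?_ e1.ge, k, hk, by
        rw [spreadDir_right hik hjk, e1]⟩
    have : m k / (1 - l) * l ≤ m i := by
      rw [div_mul_eq_mul_div, div_le_iff₀ hl]; exact hc
    linarith

lemma AtomsDominated.two_atoms_le {m s : ℕ → ℝ} {a b : ℝ} {i j : ℕ} (hij : i ≠ j)
    (h : AtomsDominated {i, j} m s a b) (hmi : 0 < m i) (hmj : 0 < m j) (hs : s i ≤ s j)
    (f φ : ℝ → ℝ) (hf : Continuous f)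
    (hφ : ∀ x ∈ Icc a b, ∀ y ∈ Icc a b, ∀ z ∈ Icc a b, φ ((x + y + z) / 3) ≤ f x + f y + f z) :
    m i * φ (s i) + m j * φ (s j) ≤ 3 * ∫ x in a..b, f x := by
  have h1 := h.mass
  have h2 := h.moment
  rw [Finset.sum_pair hij] at h1 h2
  obtain ⟨L, rfl⟩ : ∃ L, b = a + L := ⟨b - a, by ring⟩
  have hL : m i + m j = L := by linarith
  have hL0 : 0 < L := by linarith
  -- At this threshold the hinge bound says that the barycentre of the upper atom is at most that of
  -- Lebesgue measure on `[a + m i, b]`. With the moment identity this gives `s j - s i ≤ L / 2`,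
  -- hence `d ≤ 3 / 2` after rescaling.
  have h3 := h.hinge (a + m i) ⟨by linarith, by linarith⟩
  rw [Finset.sum_pair hij] at h3
  have h4 : m j * (s j - (a + m i)) ≤ m j * (m j / 2) := by
    have := mul_nonneg hmi.le (le_max_right (s i - (a + m i)) 0)
    have := mul_le_mul_of_nonneg_left (le_max_left (s j - (a + m i)) 0) hmj.le
    have e : a + L - (a + m i) = m j := by linarith
    rw [e] at h3
    linarith
  have h5 := le_of_mul_le_mul_left h4 hmj
  have h6 : m i * (s j - s i) ≤ m i * (L / 2) := by
    subst hL
    nlinarith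
  have h7 := le_of_mul_le_mul_left h6 hmi
  have hbd : ∀ x ∈ Icc (0 : ℝ) 1, L * x + a ∈ Icc a (a + L) := by
    intro x hx
    have := mul_nonneg hL0.le hx.1
    have := mul_le_of_le_one_right hL0.le hx.2
    constructor <;> linarith
  have key := two_point (fun x => f (L * x + a)) (by fun_prop) (A := φ (s i)) (B := φ (s j))
    (p := m i / L) (q := m j / L) (d := 3 * (s j - s i) / L) (by positivity) (by positivity)
    (by rw [← add_div, hL, div_self hL0.ne']) (by
      apply div_nonneg _ hL0.le; linarith)
    (by rw [div_le_iff₀ hL0]; linarith)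
    (by
      intro x hx y hy z hz hsum
      have := hφ _ (hbd x hx) _ (hbd y hy) _ (hbd z hz)
      convert! this using 2
      have e : L * (x + y + z) = L * (3 / 2) - m j * (3 * (s j - s i)) / L := by
        rw [hsum]; field_simp
      have e2 : m j * (3 * (s j - s i)) / L = 3 * (a + L / 2 - s i) := by
        rw [div_eq_iff hL0.ne']; subst hL; nlinarith
      linarith)
    (by
      intro x hx y hy z hz hsum
      have := hφ _ (hbd x hx) _ (hbd y hy) _ (hbd z hz)
      convert! this using 2
      have e : L * (x + y + z) = L * (3 / 2) + m i * (3 * (s j - s i)) / L := by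
        rw [hsum]; field_simp
      have e2 : m i * (3 * (s j - s i)) / L = 3 * (s j - a - L / 2) := by
        rw [div_eq_iff hL0.ne']; subst hL; nlinarith
      linarith)
  have e := mul_integral_comp_mul_add (a := 0) (b := 1) (f := f) L a
  rw [mul_zero, zero_add, mul_one, add_comm L a] at e
  rw [← e]
  have := mul_le_mul_of_nonneg_left key hL0.le
  calc m i * φ (s i) + m j * φ (s j) = L * (m i / L * φ (s i) + m j / L * φ (s j)) := by
        field_simp
    _ ≤ _ := this
    _ = _ := by ring

/-- Finitely supported laws dominated by the uniform distribution satisfy the dual inequality for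
three uniform summands. -/
theorem AtomsDominated.sum_le (f φ : ℝ → ℝ) (hf : Continuous f) (n : ℕ) :
    ∀ (S : Finset ℕ) (m s : ℕ → ℝ) (a b : ℝ), S.card = n → a ≤ b → AtomsDominated S m s a b →
      (∀ x ∈ Icc a b, ∀ y ∈ Icc a b, ∀ z ∈ Icc a b, φ ((x + y + z) / 3) ≤ f x + f y + f z) →
      ∑ i ∈ S, m i * φ (s i) ≤ 3 * ∫ x in a..b, f x := by
  induction n using Nat.strong_induction_on with
  | _ n ih =>
  intro S m s a b hn hab h hφ
  have herase : ∀ m' : ℕ → ℝ, AtomsDominated S m' s a b → (∃ x ∈ S, m' x = 0) →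
      ∑ i ∈ S, m' i * φ (s i) ≤ 3 * ∫ x in a..b, f x := by
    rintro m' h' ⟨x, hx, hx0⟩
    have := ih _ (by rw [← hn]; exact Finset.card_erase_lt_of_mem hx) _ _ _ _ _ rfl hab
      (h'.erase hx0) hφ
    rwa [Finset.sum_erase _ (by simp [hx0])] at this
  by_cases hz : ∃ x ∈ S, m x = 0
  · exact herase m h hz
  have hpos : ∀ x ∈ S, 0 < m x := fun x hx =>
    lt_of_le_of_ne (h.nonneg x hx) fun e => hz ⟨x, hx, e.symm⟩
  rcases Nat.lt_or_ge 2 S.card with hcard | hcard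
  · obtain ⟨i, j, k, hi, hj, hk, hij, hik, hjk, hsij, hsjk⟩ : ∃ i j k, i ∈ S ∧ j ∈ S ∧ k ∈ S ∧
        i ≠ j ∧ i ≠ k ∧ j ≠ k ∧ s i ≤ s j ∧ s j ≤ s k := by
      obtain ⟨u, hu, v, hv, w, hw, huv, huw, hvw⟩ := Finset.two_lt_card.1 hcard
      rcases le_total (s u) (s v) with h1 | h1 <;> rcases le_total (s v) (s w) with h2 | h2 <;>
        rcases le_total (s u) (s w) with h3 | h3
      · exact ⟨u, v, w, hu, hv, hw, huv, huw, hvw, h1, h2⟩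
      · exact ⟨u, v, w, hu, hv, hw, huv, huw, hvw, h1, h2⟩
      · exact ⟨u, w, v, hu, hw, hv, huw, huv, hvw.symm, h3, h2⟩
      · exact ⟨w, u, v, hw, hu, hv, huw.symm, hvw.symm, huv, h3, h1⟩
      · exact ⟨v, u, w, hv, hu, hw, huv.symm, hvw, huw, h1, h3⟩
      · exact ⟨v, w, u, hv, hw, hu, hvw, huv.symm, huw.symm, h2, h3⟩
      · exact ⟨w, v, u, hw, hv, hu, hvw.symm, huw.symm, huv.symm, h2, h1⟩
      · exact ⟨w, v, u, hw, hv, hu, hvw.symm, huw.symm, huv.symm, h2, h1⟩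
    obtain ⟨l, hl0, hl1, hs⟩ := exists_convex_weight hsij hsjk
    -- The objective is affine in the amount of mass moved, so one of the two directions does not
    -- decrease it.
    rcases le_total 0 (l * φ (s i) - φ (s j) + (1 - l) * φ (s k)) with hD | hD
    · obtain ⟨τ, hτ, hdom, hcase⟩ := h.exists_spread hi hj hk hij hik hjk hpos hsij hsjk hl0 hl1 hs
      have hobj := sum_spreadDir hi hj hk l τ m fun x => φ (s x)
      have hle : ∑ x ∈ S, m x * φ (s x) ≤
          ∑ x ∈ S, (m x + τ * spreadDir i j k l x) * φ (s x) := by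
        rw [hobj]; linarith [mul_nonneg hτ hD]
      refine hle.trans ?_
      rcases hcase with h0 | ⟨c, hac, hcb, htouch⟩
      · exact herase _ hdom ⟨j, hj, h0⟩
      -- Both halves carry positive mass, hence both are nonempty and each has fewer atoms than `S`.
      · obtain ⟨d1, d2⟩ := hdom.split hac hcb htouch
        have n1 : (S.filter fun i => c < s i).Nonempty := by
          by_contra hne
          have := d2.mass
          rw [Finset.not_nonempty_iff_eq_empty.1 hne, Finset.sum_empty] at this
          linarith
        have n2 : (S.filter fun i => ¬ c < s i).Nonempty := by
          by_contra hne
          have := d1.mass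
          rw [Finset.not_nonempty_iff_eq_empty.1 hne, Finset.sum_empty] at this
          linarith
        have hcs := Finset.card_filter_add_card_filter_not (s := S) (fun i => c < s i)
        have c1 := n1.card_pos
        have c2 := n2.card_pos
        have r1 := ih _ (by omega) _ _ _ _ _ rfl hac.le d1 fun x hx y hy z hz =>
          hφ x ⟨hx.1, hx.2.trans hcb.le⟩ y ⟨hy.1, hy.2.trans hcb.le⟩ z ⟨hz.1, hz.2.trans hcb.le⟩
        have r2 := ih _ (by omega) _ _ _ _ _ rfl hcb.le d2 fun x hx y hy z hz =>
          hφ x ⟨hac.le.trans hx.1, hx.2⟩ y ⟨hac.le.trans hy.1, hy.2⟩ z ⟨hac.le.trans hz.1, hz.2⟩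
        rw [← integral_add_adjacent_intervals (hf.intervalIntegrable a c)
          (hf.intervalIntegrable c b),
          ← Finset.sum_filter_add_sum_filter_not S (fun i => c < s i)]
        linarith
    · obtain ⟨τ, hτ, hdom, hzero⟩ := h.exists_contract hi hj hk hij hik hjk hpos hl0 hl1 hs
      have hobj := sum_spreadDir hi hj hk l τ m fun x => φ (s x)
      refine le_trans ?_ (herase _ hdom hzero)
      rw [hobj]
      linarith [mul_nonneg_of_nonpos_of_nonpos hτ hD]
  · have hcases : S.card = 0 ∨ S.card = 1 ∨ S.card = 2 := by omega
    rcases hcases with h0 | h1 | h2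
    · obtain rfl := Finset.card_eq_zero.1 h0
      have := h.mass
      rw [Finset.sum_empty] at this
      obtain rfl : a = b := by linarith
      simp
    · obtain ⟨i, rfl⟩ := Finset.card_eq_one.1 h1
      have e1 := h.mass
      have e2 := h.moment
      rw [Finset.sum_singleton] at e1 e2 ⊢
      have hsi : s i = (a + b) / 2 := by
        have hm := (hpos i (by simp)).ne'
        apply mul_left_cancel₀ hm
        rw [e2, e1]; ring
      rw [e1]
      refine uniform_block f hf hab fun x hx y hy z hz hsum => ?_
      rw [hsi]
      convert! hφ x hx y hy z hz using 2
      rw [hsum]; ring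
    · obtain ⟨i, j, hij, rfl⟩ := Finset.card_eq_two.1 h2
      rw [Finset.sum_pair hij]
      rcases le_total (s i) (s j) with hs | hs
      · exact h.two_atoms_le hij (hpos i (by simp)) (hpos j (by simp)) hs f φ hf hφ
      · rw [Finset.pair_comm] at h
        rw [add_comm]
        exact h.two_atoms_le hij.symm (hpos j (by simp)) (hpos i (by simp)) hs f φ hf hφ

/-! ### The dual inequality for general laws and three summands. -/

/-- A law on `[-1, 1]` that is dominated in the convex order by the uniform law on `[-1, 1]`. -/
structure UniformDominated (G : Measure ℝ) : Prop where
  ae_mem : ∀ᵐ s ∂G, s ∈ Icc (-1 : ℝ) 1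
  mean : ∫ s, s ∂G = 0
  hinge : ∀ t ∈ Icc (-1 : ℝ) 1, ∫ s, max (s - t) 0 ∂G ≤ (1 - t) ^ 2 / 4

/-- The bound on the integral of `φ` dual to the existence of `n` uniform variables on `[-1, 1]`
whose average has a given law dominated by the uniform law. -/
def DualBound (n : ℕ) : Prop :=
  ∀ (G : Measure ℝ) [IsProbabilityMeasure G], UniformDominated G →
    ∀ f φ : ℝ → ℝ, Continuous f → Continuous φ →
      (∀ x : Fin n → ℝ, (∀ i, x i ∈ Icc (-1 : ℝ) 1) → φ ((∑ i, x i) / n) ≤ ∑ i, f (x i)) →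
      ∫ s, φ s ∂G ≤ n / 2 * ∫ x in (-1 : ℝ)..1, f x

lemma integrable_of_ae_mem_Icc {α : Type*} [MeasurableSpace α] {μ : Measure α} [IsFiniteMeasure μ]
    {X : α → ℝ} (hX : AEMeasurable X μ) {a b : ℝ} (h : ∀ᵐ s ∂μ, X s ∈ Icc a b) {g : ℝ → ℝ}
    (hg : Continuous g) : Integrable (fun s => g (X s)) μ := by
  obtain ⟨C, hC⟩ := isCompact_Icc.exists_bound_of_continuousOn (s := Icc a b) hg.continuousOn
  refine Integrable.of_bound (hg.measurable.comp_aemeasurable hX).aestronglyMeasurable C ?_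
  filter_upwards [h] with s hs using hC _ hs

lemma UniformDominated.integrable {G : Measure ℝ} [IsFiniteMeasure G] (h : UniformDominated G)
    {g : ℝ → ℝ} (hg : Continuous g) : Integrable g G :=
  integrable_of_ae_mem_Icc aemeasurable_id h.ae_mem hg

lemma abs_setAverage_sub_le {G : Measure ℝ} [IsFiniteMeasure G] {E : Set ℝ}
    {δ x : ℝ} (hi : IntegrableOn (fun s => s) E G) (h0 : G.real E ≠ 0)
    (h : ∀ y ∈ E, |y - x| ≤ δ) : |(∫ s in E, s ∂G) / G.real E - x| ≤ δ := by
  have hpos : 0 < G.real E := lt_of_le_of_ne measureReal_nonneg h0.symm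
  have e : (∫ s in E, s ∂G) / G.real E - x = (∫ s in E, (s - x) ∂G) / G.real E := by
    rw [MeasureTheory.integral_sub hi (integrable_const _)]
    simp
    field_simp
  rw [e, abs_div, abs_of_pos hpos, div_le_iff₀ hpos]
  have := norm_setIntegral_le_of_norm_le_const (μ := G) (s := E) (f := fun s => s - x) (C := δ)
    (measure_lt_top _ _) (fun y hy => h y hy)
  simpa using this

/-- Replacing each bin by its barycentre lowers hinge integrals, by Jensen. The factor `2` passes
from probability mass to the length of `[-1, 1]`; a null bin has barycentre `0 / 0 = 0` with weight
zero. -/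
lemma UniformDominated.atomsDominated {G : Measure ℝ} [IsProbabilityMeasure G]
    (h : UniformDominated G) {M : ℕ} {E : ℕ → Set ℝ}
    (hsum : ∀ g : ℝ → ℝ, Continuous g → ∫ s, g s ∂G = ∑ k ∈ Finset.range M, ∫ s in E k, g s ∂G) :
    AtomsDominated (Finset.range M) (fun k => 2 * G.real (E k))
      (fun k => (∫ s in E k, s ∂G) / G.real (E k)) (-1) 1 := by
  have hmul : ∀ k, G.real (E k) * ((∫ s in E k, s ∂G) / G.real (E k)) = ∫ s in E k, s ∂G := by
    intro k
    by_cases h0 : G.real (E k) = 0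
    · rw [h0, zero_mul, setIntegral_measure_zero]
      exact (measureReal_eq_zero_iff).1 h0
    · field_simp
  refine ⟨fun i _ => by positivity, ?_, ?_, ?_⟩
  · have := hsum (fun _ => 1) continuous_const
    simp only [MeasureTheory.integral_const, smul_eq_mul, mul_one, probReal_univ,
      measureReal_restrict_apply_univ] at this
    rw [← Finset.mul_sum, ← this]; norm_num
  · have := hsum (fun s => s) continuous_id
    rw [h.mean] at this
    simp only [mul_assoc, hmul]
    rw [← Finset.mul_sum, ← this]; norm_num
  · intro t ht
    have := hsum (fun s => max (s - t) 0) (by fun_prop)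
    have hle : ∀ k, 2 * G.real (E k) * max ((∫ s in E k, s ∂G) / G.real (E k) - t) 0 ≤
        2 * ∫ s in E k, max (s - t) 0 ∂G := by
      intro k
      have i1 : IntegrableOn (fun s => max (s - t) 0) (E k) G :=
        (h.integrable (by fun_prop)).integrableOn
      have i2 : IntegrableOn (fun s => s - t) (E k) G :=
        (h.integrable (by fun_prop)).integrableOn
      have i3 : IntegrableOn (fun s => s) (E k) G :=
        (h.integrable (by fun_prop)).integrableOn
      rw [mul_assoc, mul_max_of_nonneg _ _ measureReal_nonneg, mul_zero, mul_sub, hmul]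
      refine mul_le_mul_of_nonneg_left (max_le ?_ ?_) (by norm_num)
      · have := MeasureTheory.integral_mono i2 i1 (fun s => le_max_left _ _)
        rw [MeasureTheory.integral_sub i3 (integrable_const _)] at this
        simpa [measureReal_restrict_apply_univ] using this
      · exact MeasureTheory.integral_nonneg fun s => le_max_right _ _
    calc _ ≤ ∑ k ∈ Finset.range M, 2 * ∫ s in E k, max (s - t) 0 ∂G :=
          Finset.sum_le_sum fun k _ => hle k
      _ ≤ _ := by rw [← Finset.mul_sum, ← this]; linarith [h.hinge t ht]

/-- The extra bin, of index `N`, catches the endpoint `s = 1`. -/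
lemma UniformDominated.integral_eq_sum_bins {G : Measure ℝ} [IsProbabilityMeasure G]
    (h : UniformDominated G) (N : ℕ) {g : ℝ → ℝ} (hg : Continuous g) :
    ∫ s, g s ∂G = ∑ k ∈ Finset.range (N + 1),
      ∫ s in {s | s ∈ Icc (-1 : ℝ) 1 ∧ ⌊(s + 1) / 2 * N⌋₊ = k}, g s ∂G := by
  have hm : Measurable fun s : ℝ => ⌊(s + 1) / 2 * N⌋₊ := by fun_prop
  rw [← integral_biUnion_finset (Finset.range (N + 1))
    (s := fun k => {s | s ∈ Icc (-1 : ℝ) 1 ∧ ⌊(s + 1) / 2 * N⌋₊ = k}) (fun k _ => measurableSet_Icc.inter (hm (measurableSet_singleton k)))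
    (fun i _ j _ hij => Set.disjoint_left.2 fun s h1 h2 => hij (h1.2.symm.trans h2.2))
    (fun k _ => (h.integrable hg).integrableOn)]
  symm
  have : ∀ᵐ s ∂G, s ∈ ⋃ k ∈ Finset.range (N + 1),
      {s | s ∈ Icc (-1 : ℝ) 1 ∧ ⌊(s + 1) / 2 * N⌋₊ = k} := by
    filter_upwards [h.ae_mem] with s hs
    simp only [mem_iUnion, Finset.mem_range, exists_prop, mem_ofPred_eq]
    refine ⟨_, ?_, hs, rfl⟩
    have : (s + 1) / 2 * N ≤ N := mul_le_of_le_one_left (by positivity) (by linarith [hs.2])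
    have := Nat.floor_le_floor this
    rw [Nat.floor_natCast] at this
    omega
  rw [Measure.restrict_eq_self_of_ae_mem this]

lemma dualBound_three : DualBound 3 := by
  intro G _ h f φ hf hφ hfφ
  refine le_of_forall_pos_le_add fun ε hε => ?_
  have huc := isCompact_Icc.uniformContinuousOn_of_continuous (hφ.continuousOn (s := Icc (-1) 1))
  obtain ⟨δ, hδ, huc⟩ := Metric.uniformContinuousOn_iff.1 huc ε hε
  obtain ⟨N, hN⟩ := exists_nat_gt (2 / δ)
  have hN0 : (0 : ℝ) < N := (div_pos two_pos hδ : 0 < 2 / δ).trans hN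
  -- Bins are narrower than the modulus of continuity of `φ`, so moving their mass to the barycentre
  -- costs at most `ε` in total.
  have hNδ : 2 / N < δ := (div_lt_comm₀ hδ hN0).1 hN
  set E : ℕ → Set ℝ := fun k => {s | s ∈ Icc (-1 : ℝ) 1 ∧ ⌊(s + 1) / 2 * N⌋₊ = k} with hEdef
  have hm : Measurable fun s : ℝ => ⌊(s + 1) / 2 * N⌋₊ := by fun_prop
  have hE : ∀ k, MeasurableSet (E k) := fun k =>
    measurableSet_Icc.inter (hm (measurableSet_singleton k))
  have hsum : ∀ g : ℝ → ℝ, Continuous g →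
      ∫ s, g s ∂G = ∑ k ∈ Finset.range (N + 1), ∫ s in E k, g s ∂G :=
    fun g hg => h.integral_eq_sum_bins N hg
  have hdist : ∀ k, ∀ x ∈ E k, ∀ y ∈ E k, |y - x| ≤ 2 / N := by
    have key : ∀ k, ∀ x ∈ E k, ∀ y ∈ E k, y - x ≤ 2 / N := by
      intro k x hx y hy
      have h1 : (k : ℝ) ≤ (x + 1) / 2 * N := by
        have := hx.2 ▸ Nat.floor_le (a := (x + 1) / 2 * N)
          (mul_nonneg (by linarith [hx.1.1]) hN0.le)
        exact this
      have h2 : (y + 1) / 2 * N < k + 1 := hy.2 ▸ Nat.lt_floor_add_one ((y + 1) / 2 * N)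
      rw [le_div_iff₀ hN0]; linarith
    intro k x hx y hy
    exact abs_le.2 ⟨by linarith [key k y hy x hx], key k x hx y hy⟩
  have hd := h.atomsDominated hsum
  have hmain := hd.sum_le f φ hf _ _ _ _ _ _ rfl (by norm_num) fun x hx y hy z hz => by
    have := hfφ ![x, y, z] (fun i => by fin_cases i <;> simpa)
    simpa [Fin.sum_univ_three] using this
  have hbin : ∀ k, ∫ s in E k, φ s ∂G ≤
      G.real (E k) * φ ((∫ s in E k, s ∂G) / G.real (E k)) + G.real (E k) * ε := by
    intro k
    by_cases h0 : G.real (E k) = 0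
    · rw [setIntegral_measure_zero _ ((measureReal_eq_zero_iff).1 h0), h0]; simp
    have i3 : IntegrableOn (fun s => s) (E k) G := (h.integrable (by fun_prop)).integrableOn
    have hpos : 0 < G.real (E k) := lt_of_le_of_ne measureReal_nonneg (Ne.symm h0)
    set c := (∫ s in E k, s ∂G) / G.real (E k) with hc
    have hc1 : c ∈ Icc (-1 : ℝ) 1 := by
      have := abs_setAverage_sub_le (x := 0) (δ := 1) i3 h0
        (fun y hy => by rw [sub_zero]; exact abs_le.2 ⟨hy.1.1, hy.1.2⟩)
      rw [sub_zero] at this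
      exact abs_le.1 this
    have hle : ∀ s ∈ E k, φ s ≤ φ c + ε := by
      intro s hs
      have h1 := abs_setAverage_sub_le (x := s) i3 h0 (hdist k s hs)
      have h2 := huc s hs.1 c hc1 (by rw [dist_comm, Real.dist_eq]; exact h1.trans_lt hNδ)
      rw [Real.dist_eq] at h2
      linarith [(abs_lt.1 h2).2]
    have := setIntegral_mono_on (μ := G) (h.integrable hφ).integrableOn
      (integrable_const (φ c + ε)).integrableOn (hE k) hle
    simp only [MeasureTheory.integral_const, measureReal_restrict_apply_univ, smul_eq_mul] at this
    linarith
  have hmass := hd.mass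
  calc ∫ s, φ s ∂G = ∑ k ∈ Finset.range (N + 1), ∫ s in E k, φ s ∂G := hsum φ hφ
    _ ≤ ∑ k ∈ Finset.range (N + 1),
        (G.real (E k) * φ ((∫ s in E k, s ∂G) / G.real (E k)) + G.real (E k) * ε) :=
      Finset.sum_le_sum fun k _ => hbin k
    _ ≤ _ := by
      rw [Finset.sum_add_distrib, ← Finset.sum_mul]
      simp only [mul_assoc] at hmain
      rw [← Finset.mul_sum] at hmain hmass
      push_cast
      have : ∑ k ∈ Finset.range (N + 1), G.real (E k) = 1 := by linarith
      rw [this]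
      linarith

/-! ### Duality and existence of couplings. -/

/-- A linear functional on a space of continuous functions that is positive in the order of
functions is represented by a measure. -/
lemma exists_representing_measure {K V : Type*} [TopologicalSpace K] [CompactSpace K] [T2Space K]
    [MeasurableSpace K] [BorelSpace K] [AddCommGroup V] [Module ℝ V] (T : V →ₗ[ℝ] C(K, ℝ))
    (L : V →ₗ[ℝ] ℝ) (hL : ∀ v, (∀ x, 0 ≤ T v x) → 0 ≤ L v) {e : V} (he : ∀ x, T e x = 1) :
    ∃ μ : Measure K, IsFiniteMeasure μ ∧ ∀ v, ∫ x, T v x ∂μ = L v := by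
  -- Extending on the product `V × C(K, ℝ)`, with the positive cone pulled back along `(v, h) ↦ T v
  -- + h`, requires no injectivity of `T`.
  let S : V × C(K, ℝ) →ₗ[ℝ] C(K, ℝ) := T ∘ₗ LinearMap.fst ℝ V _ + LinearMap.snd ℝ V _
  have hS : ∀ v h x, S (v, h) x = T v x + h x := fun v h x => rfl
  let s : PointedCone ℝ (V × C(K, ℝ)) := (PointedCone.positive ℝ C(K, ℝ)).comap S
  have hs : ∀ p, p ∈ s ↔ ∀ x, 0 ≤ S p x := fun p => Iff.rfl
  let F : (V × C(K, ℝ)) →ₗ.[ℝ] ℝ :=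
    ⟨Submodule.prod ⊤ ⊥, (L ∘ₗ LinearMap.fst ℝ V _).domRestrict _⟩
  obtain ⟨g, hgF, hgs⟩ := riesz_extension s F
    (by
      rintro ⟨⟨v, h⟩, hv⟩ hmem
      have h0 : h = 0 := hv.2
      subst h0
      exact hL v fun x => by simpa [hS] using (hs _).1 hmem x)
    (by
      rintro ⟨v, h⟩
      refine ⟨⟨(‖h‖ • e - v, 0), trivial, rfl⟩, (hs _).2 fun x => ?_⟩
      have := h.norm_coe_le_norm x
      rw [Real.norm_eq_abs] at this
      simp only [Prod.mk_add_mk, hS, sub_add_cancel, zero_add, map_smul, ContinuousMap.smul_apply, he,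
        smul_eq_mul]
      linarith [neg_abs_le (h x)])
  have hg0 : ∀ v, g (v, 0) = L v := fun v => hgF ⟨(v, 0), trivial, rfl⟩
  -- Both `(v, -T v)` and its negative lie in the cone, so the extension vanishes there.
  have hgT : ∀ v, g (0, T v) = L v := by
    intro v
    have h1 := hgs (v, -T v) ((hs _).2 fun x => by simp [hS])
    have h2 := hgs (-v, T v) ((hs _).2 fun x => by simp [hS])
    have e1 : (v, -T v) = (v, 0) - (0, T v) := by simp
    have e2 : (-v, T v) = -((v, 0) - (0, T v)) := by simp
    rw [e2, map_neg, map_sub, hg0] at h2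
    rw [e1, map_sub, hg0] at h1
    linarith
  let Λ₀ : CompactlySupportedContinuousMap K ℝ →ₗ[ℝ] ℝ :=
    { toFun := fun h => g (0, h.toContinuousMap)
      map_add' := fun a b => by
        rw [← map_add, Prod.mk_add_mk, add_zero]; rfl
      map_smul' := fun c a => by
        rw [RingHom.id_apply, ← map_smul, Prod.smul_mk, smul_zero]; rfl }
  let Λ := PositiveLinearMap.mk₀ Λ₀ fun h hh => hgs _ ((hs _).2 fun x => by
    simpa [hS] using hh x)
  have hΛ : ∀ h : C(K, ℝ), ∫ x, h x ∂(RealRMK.rieszMeasure Λ) = g (0, h) := fun h =>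
    RealRMK.integral_rieszMeasure Λ (CompactlySupportedContinuousMap.continuousMapEquiv h)
  refine ⟨RealRMK.rieszMeasure Λ, ⟨?_⟩, fun v => by rw [hΛ, hgT]⟩
  have := IsCompact.measure_lt_top (μ := RealRMK.rieszMeasure Λ) isCompact_univ
  exact this

lemma integral_uniformLaw (f : ℝ → ℝ) :
    ∫ x, f x ∂(uniformLaw (-1) 1) = 1 / 2 * ∫ x in (-1 : ℝ)..1, f x := by
  rw [uniformLaw, ProbabilityTheory.cond, MeasureTheory.integral_smul_measure, Real.volume_Icc,
    intervalIntegral.integral_of_le (by norm_num), integral_Icc_eq_integral_Ioc]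
  norm_num [ENNReal.toReal_ofReal]

instance : IsProbabilityMeasure (uniformLaw (-1) 1) :=
  ProbabilityTheory.cond_isProbabilityMeasure_of_finite (by simp [Real.volume_Icc])
    (by simp [Real.volume_Icc])

lemma sum_sum_shift {n : ℕ} [NeZero n] (F : Fin n → Fin n → ℝ) :
    ∑ k, ∑ i, F i (i + k) = ∑ j, ∑ i, F i j := by
  rw [Finset.sum_comm]
  refine Eq.trans (Finset.sum_congr rfl fun i _ => ?_) Finset.sum_comm
  exact Equiv.sum_comp (Equiv.addLeft i) (F i)

/-- If all averages of `n` points satisfy the dual bound then `n` uniform variables with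
average distributed according to a given dominated law exist. -/
lemma DualBound.exists_coupling {n : ℕ} [NeZero n] (hD : DualBound n) {G : Measure ℝ}
    [IsProbabilityMeasure G] (hG : UniformDominated G) :
    ∃ μ : Measure (Fin n → ℝ), IsProbabilityMeasure μ ∧
      (∀ i, μ.map (fun x => x i) = uniformLaw (-1) 1) ∧ μ.map (fun x => (∑ i, x i) / (n : ℝ)) = G := by
  have hn : (n : ℝ) ≠ 0 := NeZero.ne _
  let K := Fin n → Icc (-1 : ℝ) 1
  let T : (Fin n → C(ℝ, ℝ)) × C(ℝ, ℝ) →ₗ[ℝ] C(K, ℝ) :=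
    { toFun := fun v => ⟨fun x => ∑ i, v.1 i (x i) + v.2 ((∑ i, (x i : ℝ)) / n), by fun_prop⟩
      map_add' := fun v w => by
        ext x
        simp only [Prod.fst_add, Prod.snd_add, Pi.add_apply, ContinuousMap.add_apply,
          ContinuousMap.coe_mk, Finset.sum_add_distrib]
        ring
      map_smul' := fun c v => by
        ext x
        simp only [Prod.smul_fst, Prod.smul_snd, Pi.smul_apply, ContinuousMap.smul_apply,
          ContinuousMap.coe_mk, smul_eq_mul, RingHom.id_apply, ← Finset.mul_sum]
        ring }
  have hT : ∀ v (x : K), T v x = ∑ i, v.1 i (x i) + v.2 ((∑ i, (x i : ℝ)) / n) :=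
    fun v x => rfl
  have hint : ∀ h : C(ℝ, ℝ), IntervalIntegrable (fun x => h x) volume (-1) 1 :=
    fun h => h.continuous.intervalIntegrable _ _
  have hGi : ∀ h : C(ℝ, ℝ), Integrable (fun x => h x) G := fun h => hG.integrable h.continuous
  let L : (Fin n → C(ℝ, ℝ)) × C(ℝ, ℝ) →ₗ[ℝ] ℝ :=
    { toFun := fun v => ∑ i, 1 / 2 * (∫ x in (-1 : ℝ)..1, v.1 i x) + ∫ s, v.2 s ∂G
      map_add' := fun v w => by
        simp only [Prod.fst_add, Prod.snd_add, Pi.add_apply, ContinuousMap.add_apply]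
        rw [MeasureTheory.integral_add (hGi _) (hGi _)]
        simp only [intervalIntegral.integral_add (hint _) (hint _), mul_add,
          Finset.sum_add_distrib]
        ring
      map_smul' := fun c v => by
        simp only [Prod.smul_fst, Prod.smul_snd, Pi.smul_apply, ContinuousMap.smul_apply,
          smul_eq_mul, RingHom.id_apply, intervalIntegral.integral_const_mul,
          MeasureTheory.integral_const_mul, mul_add, Finset.mul_sum]
        congr 1
        exact Finset.sum_congr rfl fun i _ => by ring }
  have hL : ∀ v, L v = ∑ i, 1 / 2 * (∫ x in (-1 : ℝ)..1, v.1 i x) + ∫ s, v.2 s ∂G :=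
    fun v => rfl
  obtain ⟨μ, hμ, hrep⟩ := exists_representing_measure T L
    (by
      intro v hv
      -- The dual problem allows a different function for each coordinate; averaging over cyclic
      -- shifts of the coordinates reduces it to their common mean.
      have := hD G hG (fun x => 1 / n * ∑ i, v.1 i x) (fun s => -v.2 s) (by fun_prop) (by fun_prop)
        (by
          intro x hx
          have key : ∀ k : Fin n, -v.2 ((∑ i, x i) / n) ≤ ∑ i, v.1 i (x (i + k)) := by
            intro k
            have h1 := hv fun i => ⟨x (i + k), hx _⟩
            rw [hT] at h1
            have h2 : ∑ i, x (i + k) = ∑ i, x i := Equiv.sum_comp (Equiv.addRight k) x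
            simp only [h2] at h1
            linarith
          have h3 := Finset.sum_le_sum fun k (_ : k ∈ Finset.univ) => key k
          rw [sum_sum_shift fun i j => v.1 i (x j)] at h3
          rw [Finset.sum_const, Finset.card_univ, Fintype.card_fin, nsmul_eq_mul] at h3
          rw [← Finset.mul_sum, one_div, ← div_eq_inv_mul, le_div_iff₀' (by positivity)]
          exact h3)
      rw [MeasureTheory.integral_neg, intervalIntegral.integral_const_mul,
        intervalIntegral.integral_finsetSum (fun i _ => hint _)] at this
      rw [hL, ← Finset.mul_sum]
      field_simp at this
      linarith) (e := (0, 1)) (fun x => by simp [hT])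
  have hprob : IsProbabilityMeasure μ := by
    have := hrep (0, 1)
    simp only [hT, hL] at this
    simp at this
    exact ⟨by rw [← ENNReal.toReal_eq_one_iff]; exact this⟩
  let ι : K → Fin n → ℝ := fun x i => x i
  have hι : Continuous ι := by fun_prop
  have hιm : Measurable ι := hι.measurable
  refine ⟨μ.map ι, Measure.isProbabilityMeasure_map hιm.aemeasurable, fun i => ?_, ?_⟩
  · have hm : Measurable fun x : Fin n → ℝ => x i := measurable_pi_apply i
    have := Measure.isProbabilityMeasure_map (μ := μ) hιm.aemeasurable
    have := Measure.isProbabilityMeasure_map (μ := μ.map ι) hm.aemeasurable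
    refine ext_of_forall_integral_eq_of_IsFiniteMeasure fun h => ?_
    rw [integral_map hm.aemeasurable h.continuous.aestronglyMeasurable,
      integral_map hιm.aemeasurable (Continuous.aestronglyMeasurable (by fun_prop)),
      integral_uniformLaw]
    have := hrep (Pi.single i h.toContinuousMap, 0)
    simp only [hT, hL, Pi.single_apply, ContinuousMap.zero_apply, MeasureTheory.integral_zero,
      add_zero] at this
    rw [Finset.sum_eq_single i (fun j _ hj => by simp [hj]) (by simp)] at this
    simp only [if_true] at this
    refine Eq.trans (integral_congr_ae (ae_of_all _ fun x => ?_)) this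
    simp only
    rw [Finset.sum_eq_single i (fun j _ hj => by simp [hj]) (by simp)]
    simp [ι]
  · have hm : Measurable fun x : Fin n → ℝ => (∑ i, x i) / n := by fun_prop
    have := Measure.isProbabilityMeasure_map (μ := μ) hιm.aemeasurable
    have := Measure.isProbabilityMeasure_map (μ := μ.map ι) hm.aemeasurable
    refine ext_of_forall_integral_eq_of_IsFiniteMeasure fun h => ?_
    rw [integral_map hm.aemeasurable h.continuous.aestronglyMeasurable,
      integral_map hιm.aemeasurable (Continuous.aestronglyMeasurable (by fun_prop))]
    have := hrep (0, h.toContinuousMap)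
    simpa [hT, hL] using this

/-! ### Subconvex combinations and induction on the number of summands. -/

lemma ae_mem_uniformLaw : ∀ᵐ s ∂(uniformLaw (-1) 1), s ∈ Icc (-1 : ℝ) 1 :=
  ProbabilityTheory.ae_cond_mem measurableSet_Icc

lemma integral_hinge {t : ℝ} (ht : t ∈ Icc (-1 : ℝ) 1) :
    ∫ x in (-1 : ℝ)..1, max (x - t) 0 = (1 - t) ^ 2 / 2 := by
  have hc : Continuous fun x : ℝ => max (x - t) 0 := by fun_prop
  rw [← integral_add_adjacent_intervals (hc.intervalIntegrable (-1) t) (hc.intervalIntegrable t 1),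
    integral_congr (g := fun _ => (0 : ℝ)) fun x hx => ?_,
    integral_congr (g := fun x => x - t) (a := t) fun x hx => ?_]
  · rw [intervalIntegral.integral_sub (by simp) (by simp)]
    simp
    ring
  · rw [uIcc_of_le ht.2] at hx
    exact max_eq_left (by linarith [hx.1])
  · rw [uIcc_of_le ht.1] at hx
    exact max_eq_right (by linarith [hx.2])

/-- A subconvex combination of uniform variables has a law dominated by the uniform law. -/
lemma uniformDominated_combination {Ω ι : Type*} [MeasurableSpace Ω] [Fintype ι] {P : Measure Ω}
    [IsProbabilityMeasure P] {X : ι → Ω → ℝ} (hX : ∀ i, Measurable (X i))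
    (hlaw : ∀ i, P.map (X i) = uniformLaw (-1) 1) {c : ι → ℝ} (hc : ∀ i, 0 ≤ c i)
    (hc1 : ∑ i, c i ≤ 1) : UniformDominated (P.map fun ω => ∑ i, c i * X i ω) := by
  have hm : Measurable fun ω => ∑ i, c i * X i ω := by fun_prop
  have hmem : ∀ i, ∀ᵐ ω ∂P, X i ω ∈ Icc (-1 : ℝ) 1 := fun i =>
    ae_of_ae_map (hX i).aemeasurable (by rw [hlaw]; exact ae_mem_uniformLaw)
  have hi : ∀ i (g : ℝ → ℝ), Continuous g → Integrable (fun ω => g (X i ω)) P :=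
    fun i g hg => integrable_of_ae_mem_Icc (hX i).aemeasurable (hmem i) hg
  have hint : ∀ i (g : ℝ → ℝ), Continuous g →
      ∫ ω, g (X i ω) ∂P = 1 / 2 * ∫ x in (-1 : ℝ)..1, g x := fun i g hg => by
    rw [← integral_uniformLaw, ← hlaw i,
      integral_map (hX i).aemeasurable hg.aestronglyMeasurable]
  have hmemS : ∀ᵐ ω ∂P, ∑ i, c i * X i ω ∈ Icc (-1 : ℝ) 1 := by
    filter_upwards [ae_all_iff.2 hmem] with ω hω
    refine abs_le.1 ((Finset.abs_sum_le_sum_abs _ _).trans (le_trans ?_ hc1))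
    refine Finset.sum_le_sum fun i _ => ?_
    rw [abs_mul, abs_of_nonneg (hc i)]
    exact mul_le_of_le_one_right (hc i) (abs_le.2 (hω i))
  refine ⟨(ae_map_iff hm.aemeasurable measurableSet_Icc).2 hmemS, ?_, fun t ht => ?_⟩
  · rw [integral_map hm.aemeasurable (by fun_prop),
      integral_finsetSum _ fun i _ => (hi i (fun x => x) continuous_id).const_mul _]
    refine Finset.sum_eq_zero fun i _ => ?_
    rw [MeasureTheory.integral_const_mul, hint i (fun x => x) continuous_id]
    simp
  · have hcont : Continuous fun s : ℝ => max (s - t) 0 := by fun_prop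
    rw [integral_map hm.aemeasurable hcont.aestronglyMeasurable]
    -- Jensen, with the missing weight `1 - ∑ c i` placed at the point `0`.
    have hpt : ∀ ω, max (∑ i, c i * X i ω - t) 0 ≤
        ∑ i, c i * max (X i ω - t) 0 + (1 - ∑ i, c i) * max (-t) 0 := by
      intro ω
      have h1 : ∑ i, c i * (X i ω - t) ≤ ∑ i, c i * max (X i ω - t) 0 :=
        Finset.sum_le_sum fun i _ => mul_le_mul_of_nonneg_left (le_max_left _ _) (hc i)
      have h2 : 0 ≤ ∑ i, c i * max (X i ω - t) 0 :=
        Finset.sum_nonneg fun i _ => mul_nonneg (hc i) (le_max_right _ _)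
      simp only [mul_sub, Finset.sum_sub_distrib, ← Finset.sum_mul] at h1
      have h3 : (1 - ∑ i, c i) * (-t) ≤ (1 - ∑ i, c i) * max (-t) 0 :=
        mul_le_mul_of_nonneg_left (le_max_left _ _) (by linarith)
      exact max_le (by linarith) (add_nonneg h2 (mul_nonneg (by linarith) (le_max_right _ _)))
    have hs : Integrable (fun ω => ∑ i, c i * max (X i ω - t) 0) P :=
      integrable_finsetSum _ fun i _ => (hi i _ hcont).const_mul _
    refine (integral_mono (integrable_of_ae_mem_Icc hm.aemeasurable hmemS hcont)
      (hs.add (integrable_const _)) hpt).trans ?_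
    simp only [Pi.add_apply]
    rw [MeasureTheory.integral_add hs (integrable_const _),
      integral_finsetSum _ fun i _ => (hi i _ hcont).const_mul _]
    simp only [MeasureTheory.integral_const_mul, hint _ _ hcont, integral_hinge ht,
      ← Finset.sum_mul, MeasureTheory.integral_const, probReal_univ, one_smul]
    -- The point mass at `0` satisfies the hinge bound, because `(1 + t)² ≥ 0`.
    have h0 : max (-t) 0 ≤ (1 - t) ^ 2 / 4 :=
      max_le (by nlinarith [sq_nonneg (1 + t)]) (by positivity)
    nlinarith [mul_le_mul_of_nonneg_left h0 (show 0 ≤ 1 - ∑ i, c i by linarith)]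

/-- Take uniform `x` whose average `A` has law `G`, and write `A = (n B + x 0) / (n + 1)`. Then `B`
is a convex combination of the `x i`, so its law is dominated and the bound for `n` applies to `B`.
The remaining summand is `x 0`, already uniform. The function paired with `B` is the least `m` with
`φ ((n b + y) / (n + 1)) ≤ f y + m b` for `y` in `[-1, 1]`. -/
lemma DualBound.succ {n : ℕ} [NeZero n] (hD : DualBound n) : DualBound (n + 1) := by
  intro G _ hG f φ hf hφ h
  obtain ⟨μ, _, hmar, havg⟩ := hD.exists_coupling hG
  have hn : (0 : ℝ) < n := Nat.cast_pos.2 (NeZero.pos n)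
  let ψ : ℝ → ℝ → ℝ := fun b y => φ ((n * b + y) / (n + 1)) - f y
  let m : ℝ → ℝ := fun b => sSup (ψ b '' Icc (-1) 1)
  have hψ : Continuous ↿ψ := by
    change Continuous fun p : ℝ × ℝ => φ ((n * p.1 + p.2) / (n + 1)) - f p.2
    fun_prop
  have hm : Continuous m := isCompact_Icc.continuous_sSup hψ
  have hψm : ∀ b, ∀ y ∈ Icc (-1 : ℝ) 1, ψ b y ≤ m b := fun b y hy =>
    le_csSup (isCompact_Icc.image (hψ.comp (Continuous.prodMk_right b))).bddAbove
      (mem_image_of_mem _ hy)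
  -- The coefficients of `B = ((n + 1) A - x 0) / n`: the one of `x 0` is `1 / n²`, the others `(n +
  -- 1) / n²`.
  let c : Fin n → ℝ := fun i => (n + 1) / n ^ 2 - if i = 0 then (1 / n : ℝ) else 0
  have hB : ∀ x : Fin n → ℝ, ∑ i, c i * x i = ((n + 1) * ((∑ i, x i) / n) - x 0) / n := by
    intro x
    simp only [c, sub_mul, Finset.sum_sub_distrib, ← Finset.mul_sum, ite_mul, zero_mul,
      Finset.sum_ite_eq', Finset.mem_univ, if_true]
    field_simp
  have hdom : UniformDominated (μ.map fun x => ∑ i, c i * x i) := by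
    refine uniformDominated_combination (X := fun i (x : Fin n → ℝ) => x i) measurable_pi_apply hmar
      (fun i => ?_) ?_
    · simp only [c]
      split_ifs
      · rw [sub_nonneg, div_le_div_iff₀ hn (by positivity)]; nlinarith
      · rw [sub_zero]; positivity
    · have := hB fun _ => 1
      simp only [mul_one] at this
      rw [this]
      simp
  have hBm : Measurable fun x : Fin n → ℝ => ∑ i, c i * x i := by fun_prop
  have hAm : Measurable fun x : Fin n → ℝ => (∑ i, x i) / (n : ℝ) := by fun_prop
  have hpr := Measure.isProbabilityMeasure_map (μ := μ) hBm.aemeasurable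
  have hmle := hD _ hdom f m hf hm fun x hx => csSup_le ((nonempty_Icc.2 (by norm_num)).image _) (by
    rintro _ ⟨y, hy, rfl⟩
    have := h (Fin.cons y x) (Fin.cases hy hx)
    simp only [Fin.sum_univ_succ, Fin.cons_zero, Fin.cons_succ] at this
    have e : (n * ((∑ i, x i) / n) + y) / (n + 1) = (y + ∑ i, x i) / ((n + 1 : ℕ) : ℝ) := by
      push_cast; field_simp; ring
    simp only [ψ, e]
    linarith)
  rw [integral_map hBm.aemeasurable hm.aestronglyMeasurable] at hmle
  have hmem : ∀ᵐ x ∂μ, x 0 ∈ Icc (-1 : ℝ) 1 :=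
    ae_of_ae_map (measurable_pi_apply 0).aemeasurable (by rw [hmar]; exact ae_mem_uniformLaw)
  have hf0 : ∫ x, f (x 0) ∂μ = 1 / 2 * ∫ x in (-1 : ℝ)..1, f x := by
    rw [← integral_uniformLaw, ← hmar 0,
      integral_map (measurable_pi_apply 0).aemeasurable hf.aestronglyMeasurable]
  have i0 : Integrable (fun x : Fin n → ℝ => f (x 0)) μ :=
    integrable_of_ae_mem_Icc (measurable_pi_apply 0).aemeasurable hmem hf
  have i1 : Integrable (fun x : Fin n → ℝ => m (∑ i, c i * x i)) μ :=
    integrable_of_ae_mem_Icc hBm.aemeasurable (ae_of_ae_map hBm.aemeasurable hdom.ae_mem) hm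
  have hmemA : ∀ᵐ x ∂μ, (∑ i, x i) / (n : ℝ) ∈ Icc (-1 : ℝ) 1 :=
    ae_of_ae_map hAm.aemeasurable (by rw [havg]; exact hG.ae_mem)
  have i2 : Integrable (fun x : Fin n → ℝ => φ ((∑ i, x i) / n)) μ :=
    integrable_of_ae_mem_Icc hAm.aemeasurable hmemA hφ
  calc ∫ s, φ s ∂G = ∫ x, φ ((∑ i, x i) / n) ∂μ := by
        rw [← havg, integral_map hAm.aemeasurable hφ.aestronglyMeasurable]
    _ ≤ ∫ x, (f (x 0) + m (∑ i, c i * x i)) ∂μ := by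
        refine integral_mono_ae i2 (i0.add i1) ?_
        filter_upwards [hmem] with x hx
        have := hψm (∑ i, c i * x i) (x 0) hx
        have e : (n * (∑ i, c i * x i) + x 0) / (n + 1) = (∑ i, x i) / n := by
          rw [hB]; field_simp; ring
        simp only [ψ, e] at this
        change φ _ ≤ f (x 0) + m _
        linarith
    _ ≤ _ := by
        rw [MeasureTheory.integral_add i0 i1, hf0]
        push_cast
        linarith

lemma dualBound {n : ℕ} (hn : 3 ≤ n) : DualBound n := by
  induction n, hn using Nat.le_induction with
  | base => exact dualBound_three
  | succ n hn ih =>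
    have : NeZero n := ⟨by omega⟩
    exact ih.succ

/-! ### Transfer to the given probability space. -/

/-- A probability space carrying a uniform variable carries variables of any joint law. -/
lemma exists_measurable_map_eq_of_uniform {Ω Y : Type*} [MeasurableSpace Ω] [MeasurableSpace Y]
    [StandardBorelSpace Y] [Nonempty Y] {P : Measure Ω} {U : Ω → ℝ} (hU : Measurable U)
    (hlaw : P.map U = uniformLaw (-1) 1) (μ : Measure Y) [IsProbabilityMeasure μ] :
    ∃ Z : Ω → Y, Measurable Z ∧ P.map Z = μ := by
  obtain ⟨g, hg, hgμ⟩ := μ.exists_measurable_map_eq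
  let w : ℝ → unitInterval := fun x => projIcc 0 1 zero_le_one (x / 2 + 1 / 2)
  have hw : Measurable w := (continuous_projIcc.comp (by fun_prop)).measurable
  refine ⟨fun ω => g (w (U ω)), hg.comp (hw.comp hU), ?_⟩
  have e : (uniformLaw (-1) 1).map w = volume := by
    have := Measure.isProbabilityMeasure_map (μ := uniformLaw (-1) 1) hw.aemeasurable
    refine ext_of_forall_integral_eq_of_IsFiniteMeasure fun h => ?_
    rw [integral_map hw.aemeasurable h.continuous.aestronglyMeasurable, integral_uniformLaw,
      integral_comp_div_add (fun x => h (projIcc 0 1 zero_le_one x)) two_ne_zero,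
      smul_eq_mul, intervalIntegral.integral_of_le (by norm_num), ← integral_Icc_eq_integral_Ioc]
    norm_num
    rw [← integral_subtype_comap measurableSet_Icc, ← mul_assoc, one_div_mul_cancel two_ne_zero,
      one_mul]
    refine MeasureTheory.integral_congr_ae (ae_of_all _ fun x => ?_)
    simp
  rw [← hgμ, ← e, ← hlaw, Measure.map_map hw hU, Measure.map_map hg (hw.comp hU)]
  rfl

theorem mainTheorem7 {Ω : Type*} [MeasurableSpace Ω] (P : MeasureTheory.Measure Ω)
    [MeasureTheory.IsProbabilityMeasure P] (n : ℕ) (hn : 3 ≤ n) (F : MeasureTheory.Measure ℝ)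
    (hF : F ∈ sumLaws P (fun _ : Fin n => uniformLaw (-1) 1)) (a : ℝ)
    (ha : a ∈ Set.Icc (0 : ℝ) 1) :
    scaledLaw a F ∈ sumLaws P (fun _ : Fin n => uniformLaw (-1) 1) := by
  obtain ⟨X, hX, hlaw, rfl⟩ := hF
  have : NeZero n := ⟨by omega⟩
  have hn0 : (n : ℝ) ≠ 0 := NeZero.ne _
  have hm : Measurable fun ω => ∑ i, a / n * X i ω := by fun_prop
  have hdom := uniformDominated_combination hX hlaw (c := fun _ => a / n)
    (fun _ => div_nonneg ha.1 (Nat.cast_nonneg n)) (by simp [mul_div_cancel₀ _ hn0, ha.2])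
  have := Measure.isProbabilityMeasure_map (μ := P) hm.aemeasurable
  obtain ⟨μ, _, hmar, havg⟩ := (dualBound hn).exists_coupling hdom
  -- The given summand `X 0` supplies the randomness needed to realise the coupling on `Ω`.
  obtain ⟨Z, hZ, hZμ⟩ := exists_measurable_map_eq_of_uniform (hX 0) (hlaw 0) μ
  refine ⟨fun i ω => Z ω i, fun i => (measurable_pi_apply i).comp hZ, fun i => ?_, ?_⟩
  · rw [← hmar i, ← hZμ, Measure.map_map (measurable_pi_apply i) hZ]
    rfl
  · have hA : Measurable fun x : Fin n → ℝ => (∑ i, x i) / (n : ℝ) := by fun_prop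
    have hs : Measurable fun x : Fin n → ℝ => ∑ i, x i := by fun_prop
    have e := congrArg (Measure.map fun s : ℝ => n * s) havg
    rw [← hZμ, Measure.map_map hA hZ, Measure.map_map (by fun_prop) (hA.comp hZ),
      Measure.map_map (by fun_prop) hm] at e
    rw [scaledLaw, Measure.map_map (by fun_prop) (by fun_prop)]
    convert e using 2
    · ext ω; simp [mul_div_cancel₀ _ hn0]
    · ext ω; simp only [Function.comp, ← Finset.mul_sum]; field_simp
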